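/- Let $G$ be a non-trivial finite group that is nilpotent of class at most $2$ and in which the square of every element is central. Let $\mathcal C(G)$ be the Cayley machine of $G$, i.e. the Mealy automaton with state set $G$ and alphabet $G$ which in state $g_0$ on input $g$ moves to state $g_0g$ and outputs $g_0g$. Let $\Gamma=\mathcal G(\mathcal C(G))$ be the automata group it generates, i.e. the group of permutations of the set $G^*$ of finite words over $G$ generated by the maps $g_0\circ(\cdot)$ that the automaton computes from its states $g_0\in G$. Then $\Gamma$ is a cross-wired lamplighter group, i.e. $\Gamma$ is isomorphic to a cocompact lattice in the isometry group of a Diestel–Leader graph $DL(m,n)$ with $m,n\ge 2$. Moreover, there are an integer $q\ge 2$ and a faithful, proper, vertex-transitive action of $\Gamma$ by isometries on the Diestel–Leader graph $DL(q,q)$ for which the image of $\Gamma$ in the isometry group of $DL(q,q)$ is a cocompact lattice. Here $DL(m,n)$ is the graph whose vertices are the pairs $(u,v)$ of vertices of the regular trees of degrees $m+1$ and $n+1$ with $h(u)+h(v)=0$, where $h$ is on each tree the Busemann function (height) of a fixed end; two pairs are adjacent if both components are. A cocompact lattice in a locally compact group is a discrete subgroup with compact quotient, and isometry groups of graphs carry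 the topology of pointwise convergence. -/

import Mathlib

universe u v

/-! ### Mealy automata and the groups they generate -/

/-- A Mealy automaton with state set `Q` and alphabet `A`: in state `q` on input `a` it moves to
the state `next q a` and outputs the letter `out q a`. -/
structure MealyAutomaton (Q : Type u) (A : Type v) where
  /-- the transition function -/
  next : Q → A → Q
  /-- the output function -/
  out : Q → A → A

namespace MealyAutomaton

variable {Q : Type u} {A : Type v}

/-- The function on finite words over `A` computed by the automaton started in state `q`. -/
def run (M : MealyAutomaton Q A) : Q → List A → List A
  | _, [] => []
  | q, a :: w => M.out q a :: M.run (M.next q a) w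

/-- The automaton is invertible if every state permutes the letters. -/
def IsInvertible (M : MealyAutomaton Q A) : Prop :=
  ∀ q : Q, Function.Bijective (M.out q)

theorem run_bijective {M : MealyAutomaton Q A} (hM : M.IsInvertible) (q : Q) :
    Function.Bijective (M.run q) := by
  constructor
  · intro w
    induction w generalizing q with
    | nil =>
      intro w' h
      cases w' with
      | nil => rfl
      | cons b w' => simp [run] at h
    | cons a w ih =>
      intro w' h
      cases w' with
      | nil => simp [run] at h
      | cons b w' =>
        simp only [run, List.cons.injEq] at h
        obtain rfl := (hM q).1 h.1
        rw [ih _ h.2]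
  · intro w
    induction w generalizing q with
    | nil => exact ⟨[], rfl⟩
    | cons b w ih =>
      obtain ⟨a, rfl⟩ := (hM q).2 b
      obtain ⟨w', rfl⟩ := ih (M.next q a)
      exact ⟨a :: w', rfl⟩

/-- The permutation of the set of finite words over `A` given by a state of an invertible
automaton. -/
noncomputable def statePerm (M : MealyAutomaton Q A) (hM : M.IsInvertible) (q : Q) :
    Equiv.Perm (List A) :=
  Equiv.ofBijective (M.run q) (run_bijective hM q)

/-- The automata group generated by an invertible automaton: the group of permutations of the set
of finite words generated by all the states (the product is composition of maps). -/
noncomputable def automataGroup (M : MealyAutomaton Q A) (hM : M.IsInvertible) :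
    Subgroup (Equiv.Perm (List A)) :=
  Subgroup.closure (Set.range (M.statePerm hM))

end MealyAutomaton

/-- The Cayley machine of a group `G`: states and letters are the elements of `G`; in state `g₀` on
input `g` the machine moves to the state `g₀ * g` and outputs `g₀ * g`. -/
def cayleyMachine (G : Type u) [Group G] : MealyAutomaton G G where
  next g₀ g := g₀ * g
  out g₀ g := g₀ * g

theorem cayleyMachine_isInvertible (G : Type u) [Group G] : (cayleyMachine G).IsInvertible :=
  fun q => Group.mulLeft_bijective q

/-- The automata group generated by the Cayley machine of `G`. -/
noncomputable abbrev cayleyAutomataGroup (G : Type u) [Group G] :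
    Subgroup (Equiv.Perm (List G)) :=
  (cayleyMachine G).automataGroup (cayleyMachine_isInvertible G)

/-! ### Diestel–Leader graphs -/

/-- Vertices of the regular tree of degree `q + 1` with a distinguished end, described through the
horocycles of that end. A vertex on the horocycle of height `k` is given by labels in
`{0, …, q - 1}` at the integers `i < k`, all but finitely many of which are `0`
(labels at the integers `i ≥ k` carry no information and are set to `0`). -/
@[ext]
structure HoroTree (q : ℕ) where
  /-- the height of the vertex (its Busemann function with respect to the distinguished end) -/
  height : ℤ
  /-- the labels of the edges on the ray from the vertex to the distinguished end -/
  label : ℤ →₀ ℕ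
  label_lt : ∀ i, label i < q
  label_eq_zero : ∀ i, height ≤ i → label i = 0

namespace HoroTree

/-- `v` is the parent of `w`, that is, the neighbour of `w` in the direction of the distinguished
end: `w` is one higher than `v` and has the same labels below the height of `v`. -/
def IsParent {q : ℕ} (v w : HoroTree q) : Prop :=
  w.height = v.height + 1 ∧ ∀ i < v.height, w.label i = v.label i

/-- The regular tree of degree `q + 1`: every vertex is joined to its parent and to its `q`
children. -/
def tree (q : ℕ) : SimpleGraph (HoroTree q) where
  Adj v w := v.IsParent w ∨ w.IsParent v
  symm := ⟨fun _ _ h => h.symm⟩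
  loopless := ⟨fun v h => by
    rcases h with h | h <;> · have := h.1; omega⟩

end HoroTree

/-- Vertices of the Diestel–Leader graph `DL(m, n)`: pairs of vertices of the regular trees of
degrees `m + 1` and `n + 1` whose heights add up to zero. -/
def DLVertex (m n : ℕ) : Type :=
  {p : HoroTree m × HoroTree n // p.1.height + p.2.height = 0}

/-- The Diestel–Leader graph `DL(m, n)`: two pairs are adjacent if both their components are. -/
def dlGraph (m n : ℕ) : SimpleGraph (DLVertex m n) where
  Adj v w := (HoroTree.tree m).Adj v.1.1 w.1.1 ∧ (HoroTree.tree n).Adj v.1.2 w.1.2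
  symm := ⟨fun _ _ h => ⟨h.1.symm, h.2.symm⟩⟩
  loopless := ⟨fun v h => (HoroTree.tree m).loopless.irrefl v.1.1 h.1⟩

/-! ### Isometry groups of graphs and cocompact lattices -/

/-- The isometry group of a connected graph with its path metric, that is, its automorphism
group. -/
abbrev GraphIsom {V : Type u} (X : SimpleGraph V) : Type u := X ≃g X

/-- The topology of pointwise convergence (of an automorphism and of its inverse) on the isometry
group of a graph, the vertex set being discrete. For a connected locally finite graph this is the
compact-open topology, and it makes the isometry group a locally compact group. -/
instance GraphIsom.topologicalSpace {V : Type u} (X : SimpleGraph V) :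
    TopologicalSpace (GraphIsom X) :=
  TopologicalSpace.induced (fun f => ((f : V → V), (f.symm : V → V)))
    (@instTopologicalSpaceProd (V → V) (V → V)
      (@Pi.topologicalSpace V (fun _ => V) (fun _ => ⊥))
      (@Pi.topologicalSpace V (fun _ => V) (fun _ => ⊥)))

/-- A cocompact lattice in a locally compact group: a discrete subgroup with compact quotient. -/
def IsCocompactLattice {A : Type u} [Group A] [TopologicalSpace A] (Λ : Subgroup A) : Prop :=
  DiscreteTopology Λ ∧ CompactSpace (A ⧸ Λ)

/-- A cross-wired lamplighter group is a group isomorphic to a cocompact lattice in the isometry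
group of a Diestel–Leader graph `DL(m, n)` with `m, n ≥ 2`. -/
def IsCrossWiredLamplighter (Γ : Type u) [Group Γ] : Prop :=
  ∃ m n : ℕ, 2 ≤ m ∧ 2 ≤ n ∧ ∃ φ : Γ →* GraphIsom (dlGraph m n),
    Function.Injective φ ∧ IsCocompactLattice φ.range

/-- An action of a discrete group by isometries of a locally finite graph is proper if only finitely
many group elements fail to move a given finite set of vertices off itself. -/
def IsProperGraphAction {Γ : Type u} [Group Γ] {V : Type v} {X : SimpleGraph V}
    (φ : Γ →* GraphIsom X) : Prop :=
  ∀ K : Set V, K.Finite → {γ : Γ | ((φ γ) '' K ∩ K).Nonempty}.Finite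

/-- An action by isometries of a graph is transitive if it is transitive on the vertices. -/
def IsTransitiveGraphAction {Γ : Type u} [Group Γ] {V : Type v} {X : SimpleGraph V}
    (φ : Γ →* GraphIsom X) : Prop :=
  ∀ v w : V, ∃ γ : Γ, φ γ v = w

/-! On infinite sequences over `G`, the state `g` sends `x` to `g` times the sequence of prefix
products of `x`. Let `t` be the state `1`, which is the prefix product map, and let `L g` be left
translation by the constant sequence `g`; the states are the elements `L g * t`. Let `N` be
generated by the layers `t ^ k * L(G) * t ^ (-k)`, and `N_I` by the layers with index in an interval
`I`. The heart of the proof is that `N` resembles a direct sum of its layers, although these need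
not commute: `N = N_{<k} * N_{≥k}` (`exists_layers_factors`), and `N_I ∩ N_J = N_{I ∩ J}`
(`layers_inter`).

For an abelian group this is the independence of the iterated prefix products of constant sequences
(`total_injective`). In class two it applies twice: `N` acts by translations on sequences over the
abelian group `G/Z`, and the central elements of the layers act by central translations. The two
levels are linked by `commutator_layer_mem_of_lt`: layers `j < k` commute up to central elements of
layers in `[j, k)`. Indeed, conjugation reduces to `k = 0`; then the lower layer changes only
finitely many letters, so the commutator is translation by a finitely supported central sequence,
and a triangular argument expresses it through iterates of negative index.

Moreover no nontrivial power of `t` lies in `N` (`zpow_mem_layers`), so every element is uniquely `n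
* t ^ k`. Send it to the pair of cosets `n N_{≥k}` and `n N_{<k}`. The cosets form two regular trees
with branching `q = |G|`, and the pairs are the vertices of `DL(q, q)`; edges are right
multiplications by states and their inverses (`exists_equiv_dlVertex`). Thus `DL(q, q)` is a Cayley
graph of `Γ`, and a simply transitive action on a connected locally finite graph is a cocompact
lattice (`isCocompactLattice_of_simplyTransitive`). -/

/-! ### Isometry groups of graphs and simply transitive actions -/

theorem continuous_graphIsom_apply {V : Type u} (X : SimpleGraph V) (x : V) :
    @Continuous _ _ (GraphIsom.topologicalSpace X) ⊥ (fun f : GraphIsom X => f x) := by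
  let _ : TopologicalSpace V := ⊥
  have h : Continuous (fun f : GraphIsom X => ((f : V → V), (f.symm : V → V))) :=
    continuous_induced_dom
  exact (continuous_apply x).comp (continuous_fst.comp h)

theorem isOpen_graphIsom_apply_eq {V : Type u} (X : SimpleGraph V) (x y : V) :
    IsOpen {f : GraphIsom X | f x = y} := by
  let _ : TopologicalSpace V := ⊥
  have _ : DiscreteTopology V := ⟨rfl⟩
  exact (isOpen_discrete {y}).preimage (continuous_graphIsom_apply X x)

theorem SimpleGraph.finite_setOf_walk_length_eq {V : Type u} {X : SimpleGraph V}
    (hfin : ∀ v, (X.neighborSet v).Finite) (n : ℕ) (v : V) :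
    {w | ∃ p : X.Walk v w, p.length = n}.Finite := by
  induction n generalizing v with
  | zero =>
    refine (Set.finite_singleton v).subset ?_
    rintro w ⟨p, hp⟩
    exact (SimpleGraph.Walk.eq_of_length_eq_zero hp).symm
  | succ n ih =>
    refine ((hfin v).biUnion fun w _ => ih w).subset ?_
    rintro w ⟨p, hp⟩
    cases p with
    | nil => simp at hp
    | cons h p =>
      simp only [SimpleGraph.Walk.length_cons, Nat.add_right_cancel_iff] at hp
      exact Set.mem_biUnion h ⟨p, hp⟩

/-- Vertex stabilizers in the isometry group of a connected locally finite graph are compact. -/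
theorem isCompact_graphIsom_stabilizer {V : Type u} {X : SimpleGraph V} (hconn : X.Preconnected)
    (hfin : ∀ v, (X.neighborSet v).Finite) (v : V) :
    IsCompact {f : GraphIsom X | f v = v} := by
  let _ : TopologicalSpace V := ⊥
  have _ : DiscreteTopology V := ⟨rfl⟩
  let F : GraphIsom X → (V → V) × (V → V) := fun f => ((f : V → V), (f.symm : V → V))
  have hF : Topology.IsInducing F := ⟨rfl⟩
  rw [hF.isCompact_iff]
  have p : ∀ w, X.Walk v w := fun w => (hconn v w).some
  -- An automorphism fixing `v` carries the chosen walk from `v` to `w` to a walk of the same length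
  -- from `v`, so the image of `w` has finitely many possibilities.
  let S : V → Set V := fun w => {w' | ∃ p' : X.Walk v w', p'.length = (p w).length}
  have hS : IsCompact ((Set.univ.pi S) ×ˢ (Set.univ.pi S)) :=
    (isCompact_univ_pi fun w =>
      (SimpleGraph.finite_setOf_walk_length_eq hfin _ v).isCompact).prod
    (isCompact_univ_pi fun w => (SimpleGraph.finite_setOf_walk_length_eq hfin _ v).isCompact)
  have happ1 (x : V) : Continuous fun q : (V → V) × (V → V) => q.1 x :=
    (continuous_apply x).comp continuous_fst
  have happ2 (x : V) : Continuous fun q : (V → V) × (V → V) => q.2 x :=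
    (continuous_apply x).comp continuous_snd
  have hev1 : ∀ x, Continuous fun q : (V → V) × (V → V) => q.1 (q.2 x) := by
    intro x
    rw [continuous_discrete_rng]
    intro y
    have : (fun q : (V → V) × (V → V) => q.1 (q.2 x)) ⁻¹' {y} =
        ⋃ z, {q | q.2 x = z} ∩ {q | q.1 z = y} := by
      ext q; simp
    rw [this]
    exact isOpen_iUnion fun z => ((isOpen_discrete {z}).preimage (happ2 x)).inter
      ((isOpen_discrete {y}).preimage (happ1 z))
  have hev2 : ∀ x, Continuous fun q : (V → V) × (V → V) => q.2 (q.1 x) := by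
    intro x
    rw [continuous_discrete_rng]
    intro y
    have : (fun q : (V → V) × (V → V) => q.2 (q.1 x)) ⁻¹' {y} =
        ⋃ z, {q | q.1 x = z} ∩ {q | q.2 z = y} := by
      ext q; simp
    rw [this]
    exact isOpen_iUnion fun z => ((isOpen_discrete {z}).preimage (happ1 x)).inter
      ((isOpen_discrete {y}).preimage (happ2 z))
  -- The closed conditions saying that a pair of maps is an automorphism fixing `v` together with
  -- its inverse.
  let C : Set ((V → V) × (V → V)) :=
    {q | q.1 v = v} ∩ ((⋂ x, {q | q.1 (q.2 x) = x}) ∩ ((⋂ x, {q | q.2 (q.1 x) = x}) ∩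
      ⋂ x, ⋂ y, {q | X.Adj (q.1 x) (q.1 y) ↔ X.Adj x y}))
  have hC : IsClosed C := by
    refine ((isClosed_discrete {v}).preimage (happ1 v)).inter (IsClosed.inter ?_
      (IsClosed.inter ?_ ?_))
    · exact isClosed_iInter fun x => (isClosed_discrete {x}).preimage (hev1 x)
    · exact isClosed_iInter fun x => (isClosed_discrete {x}).preimage (hev2 x)
    · exact isClosed_iInter fun x => isClosed_iInter fun y =>
        (isClosed_discrete {z : V × V | X.Adj z.1 z.2 ↔ X.Adj x y}).preimage
          ((happ1 x).prodMk (happ1 y))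
  have : F '' {f : GraphIsom X | f v = v} = ((Set.univ.pi S) ×ˢ (Set.univ.pi S)) ∩ C := by
    ext q
    constructor
    · rintro ⟨f, hf, rfl⟩
      have hf' : f.symm v = v := by
        rw [RelIso.symm_apply_eq]; exact hf.symm
      refine ⟨⟨fun w _ => ?_, fun w _ => ?_⟩, hf, ?_, ?_, ?_⟩
      · exact ⟨((p w).map f.toHom).copy hf rfl, by simp⟩
      · exact ⟨((p w).map f.symm.toHom).copy hf' rfl, by simp⟩
      · simp [F]
      · simp [F]
      · simp only [Set.mem_iInter]
        exact fun x y => f.map_rel_iff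
    · rintro ⟨-, h1, h2, h3, h4⟩
      simp only [Set.mem_iInter, Set.mem_ofPred_eq] at h1 h2 h3 h4
      exact ⟨⟨⟨q.1, q.2, h3, h2⟩, h4 _ _⟩, h1, rfl⟩
  rw [this]
  exact hS.inter_right hC

/-- A simply transitive action on a connected locally finite graph embeds the group as a cocompact
lattice in the isometry group. -/
theorem isCocompactLattice_of_simplyTransitive {Γ : Type v} [Group Γ] {V : Type u}
    {X : SimpleGraph V} (hconn : X.Preconnected) (hfin : ∀ v, (X.neighborSet v).Finite)
    (φ : Γ →* GraphIsom X) (v : V) (hφ : Function.Bijective fun γ => φ γ v) :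
    Function.Injective φ ∧ IsCocompactLattice φ.range ∧
      IsProperGraphAction φ ∧ IsTransitiveGraphAction φ := by
  have htrans : IsTransitiveGraphAction φ := by
    intro x y
    obtain ⟨γ, rfl⟩ := hφ.2 x
    obtain ⟨δ, rfl⟩ := hφ.2 y
    refine ⟨δ * γ⁻¹, ?_⟩
    change φ (δ * γ⁻¹) (φ γ v) = φ δ v
    rw [← RelIso.mul_apply, ← map_mul, inv_mul_cancel_right]
  have hfree : ∀ x γ δ, φ γ x = φ δ x → γ = δ := by
    intro x γ δ h
    obtain ⟨ε, rfl⟩ := hφ.2 x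
    change φ γ (φ ε v) = φ δ (φ ε v) at h
    rw [← RelIso.mul_apply, ← RelIso.mul_apply, ← map_mul, ← map_mul] at h
    exact mul_right_cancel (hφ.1 h)
  refine ⟨fun γ δ h => hfree v γ δ (by rw [h]), ⟨?_, ?_⟩, ?_, htrans⟩
  · rw [discreteTopology_iff_forall_isOpen]
    rintro s
    rw [isOpen_iff_forall_mem_open]
    rintro ⟨f, γ, rfl⟩ hs
    refine ⟨Subtype.val ⁻¹' {f : GraphIsom X | f v = φ γ v}, ?_,
      (isOpen_graphIsom_apply_eq X v _).preimage continuous_subtype_val, rfl⟩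
    rintro ⟨_, δ, rfl⟩ h
    obtain rfl := hfree v _ _ h
    exact hs
  -- By transitivity every coset contains an isometry fixing `v`, so the quotient is the image of a
  -- compact stabilizer.
  · have hK := (isCompact_graphIsom_stabilizer hconn hfin v).image
      (continuous_quotient_mk' (s := QuotientGroup.leftRel φ.range))
    refine ⟨hK.of_isClosed_subset isClosed_univ fun x _ => ?_⟩
    obtain ⟨f, rfl⟩ := QuotientGroup.mk_surjective x
    obtain ⟨γ, hγ⟩ := htrans v (f⁻¹ v)
    refine ⟨f * φ γ, ?_, ?_⟩
    · change f (φ γ v) = v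
      rw [hγ]
      exact f.apply_symm_apply v
    · exact QuotientGroup.mk_mul_of_mem f ⟨γ, rfl⟩
  · intro K hK
    refine ((hK.prod hK).biUnion (t := fun p => {γ | φ γ p.1 = p.2}) fun p _ => ?_).subset ?_
    · exact Set.Subsingleton.finite fun γ hγ δ hδ =>
        hfree p.1 _ _ ((show φ γ p.1 = p.2 from hγ).trans (show φ δ p.1 = p.2 from hδ).symm)
    · rintro γ ⟨_, ⟨x, hx, rfl⟩, hy⟩
      exact Set.mem_biUnion (show (x, φ γ x) ∈ K ×ˢ K from ⟨hx, hy⟩) rfl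

/-- A regular action on the vertices by graph automorphisms, given by a labelling of the vertices
by group elements that makes the adjacency relation invariant under left translations. -/
def leftTranslationAction {Γ : Type v} [Group Γ] {V : Type u} {X : SimpleGraph V} (e : Γ ≃ V)
    (he : ∀ δ γ γ', X.Adj (e (δ * γ)) (e (δ * γ')) ↔ X.Adj (e γ) (e γ')) : Γ →* GraphIsom X where
  toFun δ :=
    { toEquiv := e.symm.trans ((Equiv.mulLeft δ).trans e)
      map_rel_iff' := by
        intro a b
        simpa using he δ (e.symm a) (e.symm b) }
  map_one' := by
    ext; simp
  map_mul' γ δ := by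
    ext; simp

theorem leftTranslationAction_apply {Γ : Type v} [Group Γ] {V : Type u} {X : SimpleGraph V}
    (e : Γ ≃ V) (he : ∀ δ γ γ', X.Adj (e (δ * γ)) (e (δ * γ')) ↔ X.Adj (e γ) (e γ')) (δ γ : Γ) :
    leftTranslationAction e he δ (e γ) = e (δ * γ) := by
  simp [leftTranslationAction]

/-- If the vertices of a graph are labelled by the elements of a group so that the edges are those
of the Cayley graph of a finite generating set, then the group acts regularly on the graph as a
cocompact lattice. -/
theorem exists_regular_action {Γ : Type v} [Group Γ] {V : Type u} {X : SimpleGraph V} (e : Γ ≃ V)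
    (S : Set Γ) (hS : S.Finite) (hgen : Subgroup.closure S = ⊤)
    (hadj : ∀ γ γ', X.Adj (e γ) (e γ') ↔ γ⁻¹ * γ' ∈ S ∨ γ'⁻¹ * γ ∈ S) :
    ∃ φ : Γ →* GraphIsom X, Function.Injective φ ∧ IsCocompactLattice φ.range ∧
      IsProperGraphAction φ ∧ IsTransitiveGraphAction φ := by
  have he : ∀ δ γ γ', X.Adj (e (δ * γ)) (e (δ * γ')) ↔ X.Adj (e γ) (e γ') := by
    intro δ γ γ'
    simp [hadj, mul_assoc]
  have hreach : ∀ γ, X.Reachable (e 1) (e γ) := by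
    intro γ
    have hγ : γ ∈ Subgroup.closure S := hgen ▸ Subgroup.mem_top γ
    induction hγ using Subgroup.closure_induction_right with
    | one => rfl
    | mul_right x hx y hy ih =>
      by_cases h : X.Adj (e x) (e (x * y))
      · exact ih.trans h.reachable
      · exact absurd ((hadj _ _).2 (by simp [hy])) h
    | mul_inv_cancel x hx y hy ih =>
      exact ih.trans (SimpleGraph.Adj.reachable ((hadj _ _).2 (by simp [hy])))
  have hconn : X.Preconnected := by
    intro a b
    obtain ⟨γ, rfl⟩ := e.surjective a
    obtain ⟨δ, rfl⟩ := e.surjective b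
    exact (hreach γ).symm.trans (hreach δ)
  have hfin : ∀ v, (X.neighborSet v).Finite := by
    intro v
    obtain ⟨γ, rfl⟩ := e.surjective v
    refine ((hS.image fun s => e (γ * s)).union (hS.image fun s => e (γ * s⁻¹))).subset ?_
    intro w hw
    obtain ⟨δ, rfl⟩ := e.surjective w
    rcases (hadj _ _).1 hw with h | h
    · exact Or.inl ⟨_, h, by simp⟩
    · exact Or.inr ⟨_, h, by simp⟩
  refine ⟨leftTranslationAction e he,
    isCocompactLattice_of_simplyTransitive hconn hfin _ (e 1) ?_⟩
  simp only [leftTranslationAction_apply, mul_one]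
  exact e.bijective

/-! ### Digit expansions in filtered groups -/

/-- Supplies the digits. The identity gets number `0` so that digit sequences vanish far to the
left; values outside `H` are irrelevant. -/
theorem Subgroup.exists_numbering {Γ : Type u} [Group Γ] (H : Subgroup Γ) {q : ℕ} (hq : 0 < q)
    (hH : Nat.card H = q) :
    ∃ ι : Γ → ℕ, ι 1 = 0 ∧ (∀ x, ι x < q) ∧ (∀ x ∈ H, ∀ y ∈ H, ι x = ι y → x = y) ∧
      ∀ m < q, ∃ x ∈ H, ι x = m := by
  classical
  subst hH
  have : Finite H := Nat.finite_of_card_ne_zero hq.ne'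
  have : NeZero (Nat.card H) := ⟨hq.ne'⟩
  let e := (Finite.equivFin H).trans (Equiv.swap (Finite.equivFin H 1) 0)
  refine ⟨fun x => if h : x ∈ H then e ⟨x, h⟩ else 0, ?_, ?_, ?_, ?_⟩
  · have : e ⟨1, H.one_mem⟩ = 0 := by
      change Equiv.swap (Finite.equivFin H 1) 0 (Finite.equivFin H 1) = 0
      simp
    simp [H.one_mem, this]
  · intro x
    dsimp only
    split_ifs
    · exact (e _).2
    · exact hq
  · intro x hx y hy h
    simp only [hx, hy, dite_true] at h
    simpa using e.injective (Fin.ext h)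
  · intro m hm
    refine ⟨e.symm ⟨m, hm⟩, (e.symm ⟨m, hm⟩).2, ?_⟩
    simp

/-- A filtration of a group by a decreasing family of subgroups `A k` with complements `B k` that
grow with `k` yields digit expansions: the coset of `n` modulo `A k` is given by the digits below
`k`, and all sequences of digits that vanish far out on the left occur. -/
theorem exists_digits {Γ : Type u} [Group Γ] (N : Subgroup Γ) (A B : ℤ → Subgroup Γ) {q : ℕ}
    (hq : 0 < q) (hBN : ∀ k, B k ≤ N) (hA : Antitone A) (hB : Monotone B)
    (hex : ∀ n ∈ N, ∃ k, n ∈ A k) (hbot : ∀ k x, x ∈ A k → x ∈ B k → x = 1)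
    (hmul : ∀ k, ∀ n ∈ N, ∃ b ∈ B k, ∃ a ∈ A k, n = b * a)
    (hcard : ∀ k, Nat.card ↥(A k ⊓ B (k + 1)) = q) :
    ∃ d : Γ → ℤ → ℕ, (∀ n i, d n i < q) ∧ (∀ n ∈ N, ∃ k, ∀ i < k, d n i = 0) ∧
      (∀ k, ∀ n ∈ N, ∀ n' ∈ N, (∀ i < k, d n i = d n' i) ↔ n⁻¹ * n' ∈ A k) ∧
      ∀ k, ∀ f : ℤ → ℕ, (∀ i, f i < q) → (∃ j, ∀ i < j, f i = 0) →
        ∃ n ∈ N, ∀ i < k, d n i = f i := by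
  -- `β k n` is the unique representative in `B k` of the coset `n * A k`. The digit of `n` at `i`
  -- will be the number of `(β i n)⁻¹ * β (i + 1) n`, an element of `A i ⊓ B (i + 1)`.
  choose! β hβB a haA hβ using hmul
  have huniq : ∀ k, ∀ n ∈ N, ∀ b ∈ B k, b⁻¹ * n ∈ A k → β k n = b := by
    intro k n hn b hb h
    have h1 : b⁻¹ * β k n = b⁻¹ * n * (a k n)⁻¹ := by
      rw [mul_assoc, ← eq_mul_inv_of_mul_eq (hβ k n hn).symm]
    have h2 := hbot k (b⁻¹ * β k n) (h1 ▸ mul_mem h (inv_mem (haA k n hn)))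
      (mul_mem (inv_mem hb) (hβB k n hn))
    exact (inv_mul_eq_one.1 h2).symm
  have hβmem : ∀ k, ∀ n ∈ N, (β k n)⁻¹ * n ∈ A k := by
    intro k n hn
    have : (β k n)⁻¹ * n = a k n := by rw [inv_mul_eq_iff_eq_mul]; exact hβ k n hn
    rw [this]; exact haA k n hn
  have hβiff : ∀ k, ∀ n ∈ N, ∀ n' ∈ N, β k n = β k n' ↔ n⁻¹ * n' ∈ A k := by
    intro k n hn n' hn'
    constructor
    · intro h
      have := mul_mem (inv_mem (hβmem k n hn)) (hβmem k n' hn')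
      rw [← h] at this
      simpa [mul_assoc] using this
    · intro h
      refine (huniq k n' hn' _ (hβB k n hn) ?_).symm
      have := mul_mem (hβmem k n hn) h
      simpa [mul_assoc] using this
  have hβone : ∀ k, ∀ n ∈ A k, n ∈ N → β k n = 1 := fun k n hn hn' =>
    huniq k n hn' 1 (one_mem _) (by simpa using hn)
  have hstep : ∀ k, ∀ n ∈ N, (β k n)⁻¹ * β (k + 1) n ∈ A k ⊓ B (k + 1) := by
    intro k n hn
    have hk : k ≤ k + 1 := by omega
    refine Subgroup.mem_inf.2 ⟨?_, mul_mem (inv_mem (hB hk (hβB k n hn))) (hβB (k + 1) n hn)⟩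
    have := mul_mem (hβmem k n hn)
      (inv_mem (hA hk (hβmem (k + 1) n hn)))
    simpa [mul_assoc] using this
  choose ι hι1 hιq hιinj hιsurj using fun k => Subgroup.exists_numbering _ hq (hcard k)
  have hzero : ∀ k, ∀ n ∈ N, n ∈ A k → ∀ i < k, ι i ((β i n)⁻¹ * β (i + 1) n) = 0 := by
    intro k n hn hk i hi
    rw [hβone i n (hA (by omega) hk) hn, hβone (i + 1) n (hA (by omega) hk) hn, inv_one, one_mul,
      hι1]
  have hcoset : ∀ k, ∀ n ∈ N, ∀ n' ∈ N,
      (∀ i < k, ι i ((β i n)⁻¹ * β (i + 1) n) = ι i ((β i n')⁻¹ * β (i + 1) n')) ↔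
        n⁻¹ * n' ∈ A k := by
    intro k n hn n' hn'
    constructor
    · intro h
      obtain ⟨j₁, h₁⟩ := hex n hn
      obtain ⟨j₂, h₂⟩ := hex n' hn'
      -- At level `j` both representatives are `1`; from there on equal digits propagate their
      -- equality upwards to `k`.
      let j := min (min j₁ j₂) k
      have key : ∀ m, j ≤ m → m ≤ k → β m n = β m n' := by
        intro m hm
        induction m, hm using Int.leInduction with
        | base =>
          intro _
          rw [hβone j n (hA (by omega) h₁) hn, hβone j n' (hA (by omega) h₂) hn']
        | succ m hm ih =>
          intro hmk
          have h1 := hιinj m _ (hstep m n hn) _ (hstep m n' hn') (h m (by omega))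
          rw [ih (by omega)] at h1
          exact mul_left_cancel h1
      exact (hβiff k n hn n' hn').1 (key k (by omega) le_rfl)
    · intro h i hi
      rw [(hβiff i n hn n' hn').2 (hA (by omega) h),
        (hβiff (i + 1) n hn n' hn').2 (hA (by omega) h)]
  refine ⟨fun n i => ι i ((β i n)⁻¹ * β (i + 1) n), fun n i => hιq _ _, ?_, hcoset, ?_⟩
  · intro n hn
    obtain ⟨k, hk⟩ := hex n hn
    exact ⟨k, hzero k n hn hk⟩
  · intro k f hf ⟨j, hj⟩
    have key : ∀ m, min j k ≤ m →
        ∃ b ∈ B m, ∀ i < m, ι i ((β i b)⁻¹ * β (i + 1) b) = f i := by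
      intro m hm
      induction m, hm using Int.leInduction with
      | base =>
        refine ⟨1, one_mem _, fun i hi => ?_⟩
        rw [hj i (by omega)]
        exact hzero _ 1 (one_mem _) (one_mem _) i hi
      | succ m hm ih =>
        obtain ⟨b, hb, hbf⟩ := ih
        obtain ⟨x, ⟨hxA, hxB⟩, hx⟩ := hιsurj m (f m) (hf m)
        -- Right multiplication by `x ∈ A m` preserves the coset modulo `A m`, hence all digits
        -- below `m`, while `x` itself prescribes digit `m`.
        have hb' : b * x ∈ B (m + 1) := mul_mem (hB (by omega) hb) hxB
        refine ⟨b * x, hb', fun i hi => ?_⟩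
        rcases eq_or_lt_of_le (Int.lt_add_one_iff.1 hi) with rfl | hi
        · rw [huniq i (b * x) (hBN _ hb') b hb (by simpa using hxA),
            huniq (i + 1) (b * x) (hBN _ hb') (b * x) hb' (by simp), inv_mul_cancel_left, hx]
        · rw [← hbf i hi]
          exact ((hcoset m b (hBN _ hb) (b * x) (hBN _ hb')).2 (by simpa using hxA) i hi).symm
    obtain ⟨b, hb, h⟩ := key k (by omega)
    exact ⟨b, hBN _ hb, h⟩

/-! ### Vertices of trees from digits, and the Diestel–Leader graph as a Cayley graph -/

namespace HoroTree

/-- The vertex of given height whose labels are the digits below that height. -/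
noncomputable def ofDigits {q : ℕ} (k : ℤ) (g : ℤ → ℕ) (hg : ∀ i, g i < q)
    (h0 : ∃ j, ∀ i < j, g i = 0) : HoroTree q where
  height := k
  label := Finsupp.ofSupportFinite (fun i => if i < k then g i else 0) (by
    obtain ⟨j, hj⟩ := h0
    refine (Set.finite_Ico j k).subset fun i hi => ?_
    by_contra h
    simp only [Set.mem_Ico, not_and_or, not_le, not_lt] at h
    rcases h with h | h
    · exact hi (by simp [hj i h])
    · exact hi (by simp [h.not_gt]))
  label_lt i := by
    have := hg i
    simp only [Finsupp.ofSupportFinite_coe]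
    split_ifs <;> omega
  label_eq_zero i hi := by
    simp [Finsupp.ofSupportFinite_coe, hi.not_gt]

theorem ofDigits_label {q : ℕ} (k : ℤ) (g : ℤ → ℕ) (hg : ∀ i, g i < q)
    (h0 : ∃ j, ∀ i < j, g i = 0) (i : ℤ) :
    (ofDigits k g hg h0).label i = if i < k then g i else 0 := rfl

theorem eq_ofDigits_iff {q : ℕ} (v : HoroTree q) (k : ℤ) (g : ℤ → ℕ) (hg : ∀ i, g i < q)
    (h0 : ∃ j, ∀ i < j, g i = 0) :
    v = ofDigits k g hg h0 ↔ v.height = k ∧ ∀ i < k, g i = v.label i := by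
  constructor
  · rintro rfl
    exact ⟨rfl, fun i hi => by simp [ofDigits_label, hi]⟩
  · rintro ⟨rfl, h⟩
    ext i
    · rfl
    · rw [ofDigits_label]
      split_ifs with hi
      · exact (h i hi).symm
      · exact v.label_eq_zero i (not_lt.1 hi)

theorem isParent_ofDigits_iff {q : ℕ} (k k' : ℤ) (g g' : ℤ → ℕ) (hg : ∀ i, g i < q)
    (h0 : ∃ j, ∀ i < j, g i = 0) (hg' : ∀ i, g' i < q) (h0' : ∃ j, ∀ i < j, g' i = 0) :
    (ofDigits k g hg h0).IsParent (ofDigits k' g' hg' h0') ↔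
      k' = k + 1 ∧ ∀ i < k, g' i = g i := by
  refine and_congr_right fun h => forall₂_congr fun i hi => ?_
  change k' = k + 1 at h
  change i < k at hi
  simp [ofDigits_label, hi, show i < k' by omega]

theorem exists_finite_bound {q : ℕ} (v : HoroTree q) : ∃ j, ∀ i < j, v.label i = 0 := by
  obtain ⟨j, hj⟩ := v.label.support.bddBelow
  refine ⟨j, fun i hi => ?_⟩
  by_contra h
  exact (hj (Finsupp.mem_support_iff.2 h)).not_gt hi

end HoroTree

/-- Let `Γ` be the extension of `N = ker π` by an infinite cyclic group generated by `t`, and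
suppose `N` has a decreasing exhausting family of subgroups `A k` with complements `B k` growing
with `k`, compatible with conjugation by `t`. Then the Cayley graph of `Γ` with respect to
`(A 0 ∩ B 1) t` is a Diestel–Leader graph. -/
theorem exists_equiv_dlVertex {Γ : Type u} [Group Γ] (π : Γ →* Multiplicative ℤ) (t : Γ)
    (ht : π t = Multiplicative.ofAdd 1) (A B : ℤ → Subgroup Γ) {q : ℕ} (hq : 0 < q)
    (hAN : ∀ k, A k ≤ π.ker) (hBN : ∀ k, B k ≤ π.ker) (hA : Antitone A) (hB : Monotone B)
    (hexA : ∀ n ∈ π.ker, ∃ k, n ∈ A k) (hexB : ∀ n ∈ π.ker, ∃ k, n ∈ B k)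
    (hbot : ∀ k x, x ∈ A k → x ∈ B k → x = 1)
    (hmul : ∀ k, ∀ n ∈ π.ker, ∃ b ∈ B k, ∃ a ∈ A k, n = b * a)
    (hcard : ∀ k, Nat.card ↥(A k ⊓ B (k + 1)) = q)
    (hconj : ∀ k x, x ∈ A k ⊓ B (k + 1) ↔ t ^ (-k) * x * t ^ k ∈ A 0 ⊓ B 1) :
    ∃ e : Γ ≃ DLVertex q q, ∀ γ γ', (dlGraph q q).Adj (e γ) (e γ') ↔
      γ⁻¹ * γ' ∈ (fun h => h * t) '' (A 0 ⊓ B 1 : Subgroup Γ) ∨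
      γ'⁻¹ * γ ∈ (fun h => h * t) '' (A 0 ⊓ B 1 : Subgroup Γ) := by
  obtain ⟨d, hdq, hd0, hd, hds⟩ := exists_digits π.ker A B hq hBN hA hB hexA hbot hmul hcard
  -- The second tree has opposite height, so `A` and `B` exchange roles with `k` negated; the
  -- reversed factorization comes from factoring inverses.
  obtain ⟨d', hdq', hd0', hd', hds'⟩ := exists_digits π.ker (fun k => B (-k)) (fun k => A (-k)) hq
    (fun k => hAN _) (fun i j h => hB (by omega)) (fun i j h => hA (by omega))
    (fun n hn => (hexB n hn).imp' (fun k => -k) fun k hk => by simpa using hk)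
    (fun k x h1 h2 => hbot _ x h2 h1)
    (fun k n hn => by
      obtain ⟨b, hb, a, ha, h⟩ := hmul (-k) _ (inv_mem hn)
      exact ⟨a⁻¹, inv_mem ha, b⁻¹, inv_mem hb, by rw [← mul_inv_rev, ← h, inv_inv]⟩)
    (fun k => by
      have := hcard (-(k + 1))
      rw [inf_comm, show -(k + 1) + 1 = -k by ring] at this
      exact this)
  let p : Γ → ℤ := fun γ => (π γ).toAdd
  let nn : Γ → Γ := fun γ => γ * t ^ (-p γ)
  have hnn : ∀ γ, nn γ ∈ π.ker := by
    intro γ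
    simp only [nn, p, MonoidHom.mem_ker, map_mul, map_zpow, ht]
    apply Multiplicative.toAdd.injective
    simp
  have hp : ∀ n ∈ π.ker, ∀ k : ℤ, p (n * t ^ k) = k := by
    intro n hn k
    rw [MonoidHom.mem_ker] at hn
    simp [p, hn, ht]
  -- With `n = nn γ` and `k = p γ`, the two tree vertices encode the cosets `n * A k` and `n * B k`
  -- by their digits.
  let e₁ : Γ → HoroTree q := fun γ =>
    HoroTree.ofDigits (p γ) (d (nn γ)) (hdq _) (hd0 _ (hnn γ))
  let e₂ : Γ → HoroTree q := fun γ =>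
    HoroTree.ofDigits (-p γ) (d' (nn γ)) (hdq' _) (hd0' _ (hnn γ))
  let f : Γ → DLVertex q q := fun γ => ⟨(e₁ γ, e₂ γ), add_neg_cancel (p γ)⟩
  have hf : Function.Bijective f := by
    constructor
    · intro γ γ' h
      have h1 : e₁ γ = e₁ γ' := congrArg (fun v => v.1.1) h
      have h2 : e₂ γ = e₂ γ' := congrArg (fun v => v.1.2) h
      obtain ⟨hk, h1⟩ := (HoroTree.eq_ofDigits_iff _ _ _ _ _).1 h1
      obtain ⟨-, h2⟩ := (HoroTree.eq_ofDigits_iff _ _ _ _ _).1 h2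
      change p γ = p γ' at hk
      have h1' : (nn γ')⁻¹ * nn γ ∈ A (p γ') := (hd _ _ (hnn _) _ (hnn _)).1 fun i hi => by
        rw [h1 i hi]; exact if_pos (hk ▸ hi)
      have h2' : (nn γ')⁻¹ * nn γ ∈ B (- -p γ') := (hd' _ _ (hnn _) _ (hnn _)).1 fun i hi => by
        rw [h2 i hi]; exact if_pos (hk ▸ hi)
      have h3 := hbot _ _ h1' (by simpa using h2')
      have h4 := inv_mul_eq_one.1 h3
      simp only [nn, hk] at h4
      exact (mul_right_cancel h4).symm
    · rintro ⟨⟨w, w'⟩, hw⟩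
      change w.height + w'.height = 0 at hw
      obtain ⟨n₁, hn₁, h₁⟩ := hds w.height w.label w.label_lt w.exists_finite_bound
      obtain ⟨n₂, hn₂, h₂⟩ := hds' w'.height w'.label w'.label_lt w'.exists_finite_bound
      -- Any two cosets `n₁ * A k` and `n₂ * B k` meet: `n₂ * b = n₁ * a⁻¹` lies in both.
      obtain ⟨b, hb, a, ha, h⟩ := hmul w.height (n₂⁻¹ * n₁) (mul_mem (inv_mem hn₂) hn₁)
      have hn : n₂ * b ∈ π.ker := mul_mem hn₂ (hBN _ hb)
      have h' : n₁⁻¹ * (n₂ * b) = a⁻¹ := by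
        rw [eq_inv_iff_mul_eq_one, mul_assoc, mul_assoc, ← h]; group
      have hpk := hp _ hn w.height
      have hnk : nn (n₂ * b * t ^ w.height) = n₂ * b := by
        simp only [nn, hpk]; group
      refine ⟨n₂ * b * t ^ w.height, Subtype.ext (Prod.ext ?_ ?_)⟩
      · refine ((HoroTree.eq_ofDigits_iff w _ _ (hdq _) (hd0 _ (hnn _))).2 ⟨hpk.symm, fun i hi => ?_⟩).symm
        rw [hpk] at hi
        rw [hnk, ← h₁ i hi]
        exact ((hd _ _ hn₁ _ hn).2 (by rw [h']; exact inv_mem ha) i hi).symm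
      · refine ((HoroTree.eq_ofDigits_iff w' _ _ (hdq' _) (hd0' _ (hnn _))).2 ⟨?_, fun i hi => ?_⟩).symm
        · rw [hpk]; omega
        · have hk : -p (n₂ * b * t ^ w.height) = w'.height := by rw [hpk]; omega
          rw [hk] at hi
          rw [hnk]
          change _ = w'.label i
          rw [← h₂ i hi]
          refine ((hd' _ _ hn₂ _ hn).2 ?_ i hi).symm
          rw [inv_mul_cancel_left, show -w'.height = w.height by omega]
          exact hb
  have hS : ∀ γ γ', γ⁻¹ * γ' ∈ (fun h => h * t) '' (A 0 ⊓ B 1 : Subgroup Γ) ↔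
      p γ' = p γ + 1 ∧ (nn γ)⁻¹ * nn γ' ∈ A (p γ) ⊓ B (p γ + 1) := by
    intro γ γ'
    constructor
    · rintro ⟨h, hh, hγ⟩
      have h1 : γ' = γ * (h * t) := by rw [show h * t = γ⁻¹ * γ' from hγ]; group
      have hk : p γ' = p γ + 1 := by
        have : π h = 1 := hAN 0 hh.1
        simp [p, h1, this, ht]
      refine ⟨hk, (hconj _ _).2 ?_⟩
      have : t ^ (-p γ) * ((nn γ)⁻¹ * nn γ') * t ^ p γ = h := by
        simp only [nn, hk]
        rw [h1]
        group
      rw [this]; exact hh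
    · rintro ⟨hk, h⟩
      refine ⟨_, (hconj _ _).1 h, ?_⟩
      simp only [nn, hk]
      group
  have hadj : ∀ γ γ', (e₁ γ).IsParent (e₁ γ') ∧ (e₂ γ').IsParent (e₂ γ) ↔
      p γ' = p γ + 1 ∧ (nn γ)⁻¹ * nn γ' ∈ A (p γ) ⊓ B (p γ + 1) := by
    intro γ γ'
    rw [HoroTree.isParent_ofDigits_iff, HoroTree.isParent_ofDigits_iff]
    constructor
    · rintro ⟨⟨hk, h1⟩, -, h2⟩
      refine ⟨hk, (hd _ _ (hnn _) _ (hnn _)).1 fun i hi => (h1 i hi).symm, ?_⟩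
      have := (hd' _ _ (hnn _) _ (hnn _)).1 h2
      rwa [neg_neg, hk] at this
    · rintro ⟨hk, h1, h2⟩
      refine ⟨⟨hk, fun i hi => ((hd _ _ (hnn _) _ (hnn _)).2 h1 i hi).symm⟩, by omega, ?_⟩
      refine (hd' _ _ (hnn _) _ (hnn _)).2 ?_
      rwa [neg_neg, hk]
  refine ⟨Equiv.ofBijective f hf, fun γ γ' => ?_⟩
  rw [hS, hS, ← hadj, ← hadj]
  change ((e₁ γ).IsParent (e₁ γ') ∨ (e₁ γ').IsParent (e₁ γ)) ∧
    ((e₂ γ).IsParent (e₂ γ') ∨ (e₂ γ').IsParent (e₂ γ)) ↔ _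
  constructor
  -- Both components cannot rise together or fall together, since their heights are opposite.
  · rintro ⟨h1 | h1, h2 | h2⟩
    · have h3 := h1.1
      have h4 := h2.1
      change p γ' = p γ + 1 at h3
      change -p γ' = -p γ + 1 at h4
      omega
    · exact Or.inl ⟨h1, h2⟩
    · exact Or.inr ⟨h1, h2⟩
    · have h3 := h1.1
      have h4 := h2.1
      change p γ = p γ' + 1 at h3
      change -p γ = -p γ' + 1 at h4
      omega
  · rintro (⟨h1, h2⟩ | ⟨h1, h2⟩)
    · exact ⟨Or.inl h1, Or.inr h2⟩
    · exact ⟨Or.inr h1, Or.inl h2⟩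

/-! ### Prefix products of sequences -/

namespace PrefixProduct

section Basic

variable {H : Type u} [Group H]

/-- The sequence of the prefix products of a sequence. -/
def prods (x : ℕ → H) : ℕ → H
  | 0 => x 0
  | n + 1 => prods x n * x (n + 1)

/-- The sequence of the successive quotients of a sequence. -/
def quots (x : ℕ → H) : ℕ → H
  | 0 => x 0
  | n + 1 => (x n)⁻¹ * x (n + 1)

theorem quots_prods (x : ℕ → H) : quots (prods x) = x := by
  funext n
  cases n <;> simp [quots, prods]

theorem prods_quots (x : ℕ → H) : prods (quots x) = x := by
  funext n
  induction n with
  | zero => rfl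
  | succ n ih => simp [prods, ih, quots]

variable (H) in
/-- Taking prefix products, as a permutation of the set of sequences. -/
def perm : Equiv.Perm (ℕ → H) := ⟨prods, quots, quots_prods, prods_quots⟩

@[simp] theorem perm_apply (x : ℕ → H) : perm H x = prods x := rfl

@[simp] theorem perm_inv_apply (x : ℕ → H) : (perm H)⁻¹ x = quots x := rfl

theorem prods_map {K : Type v} [Group K] (f : H →* K) (x : ℕ → H) :
    prods (f.compLeft ℕ x) = f.compLeft ℕ (prods x) := by
  funext n
  induction n with
  | zero => rfl
  | succ n ih => simp [prods, ih]

theorem quots_map {K : Type v} [Group K] (f : H →* K) (x : ℕ → H) :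
    quots (f.compLeft ℕ x) = f.compLeft ℕ (quots x) := by
  funext n
  cases n <;> simp [quots]

end Basic

theorem zpow_semiconj {X : Type u} {Y : Type v} (f : X → Y) (σ : Equiv.Perm X) (τ : Equiv.Perm Y)
    (h : ∀ x, f (σ x) = τ (f x)) (k : ℤ) (x : X) : f ((σ ^ k) x) = (τ ^ k) (f x) := by
  have h' : ∀ x, f (σ⁻¹ x) = τ⁻¹ (f x) := by
    intro x
    rw [Equiv.Perm.eq_inv_iff_eq, ← h]
    exact congrArg f (σ.apply_symm_apply x)
  induction k generalizing x with
  | zero => rfl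
  | succ n ih => rw [zpow_add_one, zpow_add_one, Equiv.Perm.mul_apply, Equiv.Perm.mul_apply, ih, h]
  | pred n ih => rw [zpow_sub_one, zpow_sub_one, Equiv.Perm.mul_apply, Equiv.Perm.mul_apply, ih, h']

theorem perm_zpow_map {H : Type u} {K : Type v} [Group H] [Group K] (f : H →* K) (k : ℤ)
    (x : ℕ → H) : f.compLeft ℕ ((perm H ^ k) x) = (perm K ^ k) (f.compLeft ℕ x) :=
  zpow_semiconj _ _ _ (fun x => (prods_map f x).symm) k x

/-- Naturality applied to the trivial endomorphism. -/
theorem perm_zpow_one {H : Type u} [Group H] (k : ℤ) : (perm H ^ k) 1 = 1 := by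
  have h := perm_zpow_map (1 : H →* H) k 1
  have h1 : ∀ x, (1 : H →* H).compLeft ℕ x = 1 := fun x => rfl
  rw [h1, h1] at h
  exact h.symm

/-! ### Independence of iterated prefix products over an abelian group -/

section Comm

variable {H : Type u} [CommGroup H]

theorem prods_mul (x y : ℕ → H) : prods (x * y) = prods x * prods y := by
  funext n
  induction n with
  | zero => rfl
  | succ n ih =>
    simp only [prods, ih, Pi.mul_apply]
    exact mul_mul_mul_comm _ _ _ _

theorem quots_mul (x y : ℕ → H) : quots (x * y) = quots x * quots y := by
  have := prods_mul (quots x) (quots y)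
  rw [prods_quots, prods_quots] at this
  rw [← this, quots_prods]

theorem perm_zpow_mul (k : ℤ) (x y : ℕ → H) :
    (perm H ^ k) (x * y) = (perm H ^ k) x * (perm H ^ k) y := by
  induction k generalizing x y with
  | zero => rfl
  | succ n ih =>
    simp only [zpow_add_one, Equiv.Perm.mul_apply, perm_apply, prods_mul, ih]
  | pred n ih =>
    simp only [zpow_sub_one, Equiv.Perm.mul_apply, perm_inv_apply, quots_mul, ih]

/-- The `k`-fold iterated prefix products of the constant sequences. -/
def iter (k : ℤ) : H →* (ℕ → H) where
  toFun h := (perm H ^ k) (Function.const ℕ h)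
  map_one' := perm_zpow_one k
  map_mul' _ _ := perm_zpow_mul k _ _

theorem iter_apply (k : ℤ) (h : H) : iter k h = (perm H ^ k) (Function.const ℕ h) := rfl

theorem perm_zpow_iter (j k : ℤ) (h : H) : (perm H ^ j) (iter k h) = iter (j + k) h := by
  rw [iter_apply, iter_apply, zpow_add, Equiv.Perm.mul_apply]

/-- The quotients of the constant sequence `h` are `h, 1, 1, …`. Each further passage to quotients
lengthens the support by at most one place and puts there the inverse of the previous last entry. -/
theorem iter_neg_succ (m : ℕ) (h : H) :
    (∀ i, m < i → iter (-(m + 1 : ℤ)) h i = 1) ∧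
      ∃ s : ℤˣ, iter (-(m + 1 : ℤ)) h m = h ^ (s : ℤ) := by
  induction m with
  | zero =>
    have h0 : iter (-((0 : ℕ) + 1 : ℤ)) h = quots (Function.const ℕ h) := by
      simp [iter_apply]
    rw [h0]
    refine ⟨fun i hi => ?_, 1, by simp [quots]⟩
    obtain ⟨i, rfl⟩ := Nat.exists_eq_succ_of_ne_zero hi.ne'
    simp [quots]
  | succ m ih =>
    have h1 : iter (-((m + 1 : ℕ) + 1 : ℤ)) h = quots (iter (-(m + 1 : ℤ)) h) := by
      rw [← perm_inv_apply, ← zpow_neg_one, perm_zpow_iter]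
      congr 2
      push_cast; ring
    obtain ⟨ih1, s, hs⟩ := ih
    rw [h1]
    refine ⟨fun i hi => ?_, -s, ?_⟩
    · obtain ⟨i, rfl⟩ := Nat.exists_eq_succ_of_ne_zero (Nat.ne_zero_of_lt hi)
      rw [quots, ih1 i (by omega), ih1 (i + 1) (by omega), inv_one, mul_one]
    · rw [quots, ih1 (m + 1) (by omega), hs, mul_one, Units.val_neg, zpow_neg]

/-- The sum of iterated prefix products of constant sequences. -/
noncomputable def total : (ℤ →₀ Additive H) →+ Additive (ℕ → H) :=
  Finsupp.liftAddHom fun k => (iter (H := H) k).toAdditive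

theorem total_single (k : ℤ) (h : H) :
    total (Finsupp.single k (Additive.ofMul h)) = Additive.ofMul (iter k h) := by
  simp [total]

theorem eq_one_of_unit_zpow_eq_one {K : Type u} [Group K] {h : K} {s : ℤˣ}
    (hs : h ^ (s : ℤ) = 1) : h = 1 := by
  rcases Int.units_eq_one_or s with rfl | rfl <;> simpa using hs

/-- Let `a` and `b` be the least and greatest indices in the support of a relation. Applying the
power `-(b + 1)` makes all indices negative and all terms finitely supported. Only the term of index
`a` reaches position `b - a`, where its entry is `f a` up to inversion. -/
theorem total_injective : Function.Injective (total (H := H)) := by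
  rw [injective_iff_map_eq_zero]
  intro f hf
  by_contra hne
  have hsupp : f.support.Nonempty := Finsupp.support_nonempty_iff.2 hne
  let a := f.support.min' hsupp
  let b := f.support.max' hsupp
  have hab : a ≤ b := f.support.min'_le _ (f.support.max'_mem hsupp)
  obtain ⟨N, hN⟩ := Int.eq_ofNat_of_zero_le (sub_nonneg.2 hab)
  have h1 : ∏ k ∈ f.support, iter (k - (b + 1)) (f k).toMul = 1 := by
    have h2 : ∏ k ∈ f.support, iter k (f k).toMul = 1 := by
      have := congrArg Additive.toMul hf
      rw [total, Finsupp.liftAddHom_apply, Finsupp.sum, toMul_sum] at this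
      exact this
    let P : (ℕ → H) →* (ℕ → H) := ⟨⟨(perm H ^ (-(b + 1)) :), perm_zpow_one _⟩, perm_zpow_mul _⟩
    have h3 := congrArg P h2
    rw [map_one, map_prod] at h3
    rw [← h3]
    refine Finset.prod_congr rfl fun k _ => ?_
    change _ = (perm H ^ (-(b + 1))) _
    rw [perm_zpow_iter, neg_add_eq_sub]
  have h2 := congrFun h1 N
  rw [Finset.prod_apply, Finset.prod_eq_single_of_mem a (f.support.min'_mem hsupp)] at h2
  · obtain ⟨s, hs⟩ := (iter_neg_succ N (f a).toMul).2
    rw [show a - (b + 1) = -((N : ℤ) + 1) by rw [← hN]; ring, hs] at h2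
    exact Finsupp.mem_support_iff.1 (f.support.min'_mem hsupp) (eq_one_of_unit_zpow_eq_one (K := H) h2)
  · intro k hk hka
    have hak : a < k := lt_of_le_of_ne (f.support.min'_le _ hk) (Ne.symm hka)
    have hkb : k ≤ b := f.support.le_max' _ hk
    obtain ⟨m, hm⟩ := Int.eq_ofNat_of_zero_le (sub_nonneg.2 hkb)
    rw [show k - (b + 1) = -((m : ℤ) + 1) by rw [← hm]; ring]
    exact (iter_neg_succ m _).1 N (by omega)

variable (H) in
/-- The span of the `k`-fold iterated prefix products of constant sequences for `k ∈ I`. -/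
def span (I : Set ℤ) : Subgroup (ℕ → H) :=
  Subgroup.closure {x | ∃ k ∈ I, ∃ h, x = iter k h}

theorem iter_mem_span {I : Set ℤ} {k : ℤ} (hk : k ∈ I) (h : H) : iter k h ∈ span H I :=
  Subgroup.subset_closure ⟨k, hk, h, rfl⟩

theorem mem_span_iff {I : Set ℤ} {x : ℕ → H} :
    x ∈ span H I ↔ ∃ f : ℤ →₀ Additive H, ↑f.support ⊆ I ∧ total f = Additive.ofMul x := by
  classical
  constructor
  · intro hx
    induction hx using Subgroup.closure_induction with
    | mem x hx =>
      obtain ⟨k, hk, h, rfl⟩ := hx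
      refine ⟨Finsupp.single k (Additive.ofMul h), fun i hi => ?_, total_single k h⟩
      have := Finsupp.support_single_subset hi
      simp only [Finset.mem_singleton] at this
      exact this ▸ hk
    | one => exact ⟨0, by simp, by simp⟩
    | mul x y _ _ hx hy =>
      obtain ⟨f, hf, rfl'⟩ := hx
      obtain ⟨g, hg, rg⟩ := hy
      refine ⟨f + g, fun i hi => ?_, by rw [map_add, rfl', rg]; rfl⟩
      rcases Finset.mem_union.1 (Finsupp.support_add hi) with h | h
      · exact hf h
      · exact hg h
    | inv x _ hx =>
      obtain ⟨f, hf, hfx⟩ := hx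
      exact ⟨-f, by rwa [Finsupp.support_neg], by rw [map_neg, hfx]; rfl⟩
  · rintro ⟨f, hf, hx⟩
    have : x = ∏ k ∈ f.support, iter k (f k).toMul := by
      have := congrArg Additive.toMul hx
      rw [total, Finsupp.liftAddHom_apply, Finsupp.sum, toMul_sum] at this
      exact this.symm
    rw [this]
    exact Subgroup.prod_mem _ fun k hk => iter_mem_span (hf hk) _

theorem mem_span_inter {I J : Set ℤ} {x : ℕ → H} (hI : x ∈ span H I) (hJ : x ∈ span H J) :
    x ∈ span H (I ∩ J) := by
  rw [mem_span_iff] at *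
  obtain ⟨f, hf, hfx⟩ := hI
  obtain ⟨g, hg, hgx⟩ := hJ
  obtain rfl := total_injective (hfx.trans hgx.symm)
  exact ⟨f, Set.subset_inter hf hg, hfx⟩

theorem iter_left_injective {j k : ℤ} {h : H} (hh : h ≠ 1) (hjk : iter j h = iter k h) :
    j = k := by
  have h1 : total (Finsupp.single j (Additive.ofMul h)) =
      total (Finsupp.single k (Additive.ofMul h)) := by
    rw [total_single, total_single, hjk]
  rcases Finsupp.single_eq_single_iff _ _ _ _ |>.1 (total_injective h1) with h2 | h2
  · exact h2.1
  · exact absurd h2.1 hh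

/-- Triangular elimination: an iterate of index `-(m + 1)` can be chosen to cancel the entry at `m`
without disturbing later ones. -/
theorem mem_span_of_finite_support (m : ℕ) (x : ℕ → H) (hx : ∀ i, m ≤ i → x i = 1) :
    x ∈ span H (Set.Ico (-m : ℤ) 0) := by
  induction m generalizing x with
  | zero =>
    have : x = 1 := funext fun i => hx i (Nat.zero_le i)
    rw [this]; exact one_mem _
  | succ m ih =>
    have hmono : span H (Set.Ico (-m : ℤ) 0) ≤ span H (Set.Ico (-(m + 1 : ℕ) : ℤ) 0) := by
      refine Subgroup.closure_mono ?_
      rintro _ ⟨k, hk, h, rfl⟩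
      exact ⟨k, ⟨by have := hk.1; push_cast; omega, hk.2⟩, h, rfl⟩
    have key : ∃ h, iter (-(m + 1 : ℤ)) h m = x m := by
      obtain ⟨s, hs⟩ := (iter_neg_succ m (x m)).2
      -- The exponent `s` is `1` or `-1`, so applying it twice returns `x m`.
      refine ⟨x m ^ (s : ℤ), ?_⟩
      rw [map_zpow, Pi.pow_apply, hs, ← zpow_mul]
      rcases Int.units_eq_one_or s with rfl | rfl <;> simp
    obtain ⟨h, hh⟩ := key
    have h1 : x * (iter (-(m + 1 : ℤ)) h)⁻¹ ∈ span H (Set.Ico (-m : ℤ) 0) := by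
      refine ih _ fun i hi => ?_
      rcases eq_or_lt_of_le hi with rfl | hi
      · rw [Pi.mul_apply, Pi.inv_apply, hh, mul_inv_cancel]
      · rw [Pi.mul_apply, Pi.inv_apply, (iter_neg_succ m h).1 i hi, hx i hi, mul_inv_cancel]
    have h2 : iter (-(m + 1 : ℤ)) h ∈ span H (Set.Ico (-(m + 1 : ℕ) : ℤ) 0) :=
      iter_mem_span (Set.mem_Ico.2 ⟨by push_cast; omega, by omega⟩) h
    have := mul_mem (hmono h1) h2
    rwa [inv_mul_cancel_right] at this

end Comm

end PrefixProduct

/-! ### Translations with central corrections in class two -/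

namespace PrefixProduct

open scoped commutatorElement IsMulCommutative

section Central

variable {G : Type u} [Group G]

variable (G) in
/-- Sequences of central elements as sequences of group elements. -/
abbrev centralSeq : (ℕ → Subgroup.center G) →* (ℕ → G) :=
  (Subgroup.center G).subtype.compLeft ℕ

theorem centralSeq_injective : Function.Injective (centralSeq G) := fun _ _ h =>
  funext fun n => Subtype.ext (congrFun h n)

theorem centralSeq_comm (z : ℕ → Subgroup.center G) (x : ℕ → G) :
    x * centralSeq G z = centralSeq G z * x :=
  funext fun n => Subgroup.mem_center_iff.1 (z n).2 (x n)

theorem prods_centralSeq_mul (z : ℕ → Subgroup.center G) (x : ℕ → G) :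
    prods (centralSeq G z * x) = centralSeq G (prods z) * prods x := by
  funext n
  induction n with
  | zero => rfl
  | succ n ih =>
    have h := Subgroup.mem_center_iff.1 (z (n + 1)).2 (prods x n)
    simp only [Pi.mul_apply, MonoidHom.compLeft_apply, Function.comp_apply,
      Subgroup.coe_subtype, prods, Subgroup.coe_mul] at ih ⊢
    rw [ih, mul_assoc, ← mul_assoc (prods x n), h]
    simp only [mul_assoc]

theorem perm_zpow_centralSeq_mul (k : ℤ) (z : ℕ → Subgroup.center G) (x : ℕ → G) :
    (perm G ^ k) (centralSeq G z * x) =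
      centralSeq G ((perm (Subgroup.center G) ^ k) z) * (perm G ^ k) x := by
  induction k generalizing x z with
  | zero => rfl
  | succ n ih =>
    simp only [zpow_add_one, Equiv.Perm.mul_apply, perm_apply, prods_centralSeq_mul, ih]
  | pred n ih =>
    have h : quots (centralSeq G z * x) = centralSeq G (quots z) * quots x := by
      have := prods_centralSeq_mul (quots z) (quots x)
      rw [prods_quots, prods_quots] at this
      rw [← this, quots_prods]
    simp only [zpow_sub_one, Equiv.Perm.mul_apply, perm_inv_apply, h, ih]

/-- The homomorphism `x ↦ ⁅r, x⁆` of a group that is nilpotent of class at most two. -/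
def commutatorHom (hG : ∀ a b : G, ⁅a, b⁆ ∈ Subgroup.center G) (r : G) :
    G →* Subgroup.center G where
  toFun x := ⟨⁅r, x⁆, hG r x⟩
  map_one' := Subtype.ext (commutatorElement_one_right r)
  map_mul' x y := Subtype.ext (by
    have h := Subgroup.mem_center_iff.1 (hG r y) x
    simp only [Subgroup.coe_mul]
    calc ⁅r, x * y⁆ = ⁅r, x⁆ * (x * ⁅r, y⁆) * x⁻¹ := by simp only [commutatorElement_def]; group
      _ = ⁅r, x⁆ * ⁅r, y⁆ := by rw [h]; group)

theorem commutatorHom_center (hG : ∀ a b : G, ⁅a, b⁆ ∈ Subgroup.center G) (r : G)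
    (z : Subgroup.center G) : commutatorHom hG r z = 1 :=
  Subtype.ext (commutatorElement_eq_one_iff_mul_comm.2 (Subgroup.mem_center_iff.1 z.2 r))

/-- A permutation of the sequences is twisted if it is a translation up to a central correction
that depends homomorphically on the sequence modulo the centre. -/
def IsTwisted (ω : Equiv.Perm (ℕ → G)) : Prop :=
  ∃ (r : ℕ → G) (c : (ℕ → G) →* (ℕ → Subgroup.center G)),
    (∀ z, c (centralSeq G z) = 1) ∧ ∀ x, ω x = r * x * centralSeq G (c x)

/-- The computation at one letter behind `IsTwisted.exists_commutator`: `a, b` are letters of the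
two translations, and `z₁, z₂, z₃, z₄` stand for the corrections `c r'`, `c' r`, `c x`, `c' x`. -/
theorem swap_mod_center (a b x : G) (z₁ z₂ z₃ z₄ : Subgroup.center G) :
    a * (b * x * z₄) * (z₁ * z₃) = ⁅a, b⁆ * z₁ * (z₂ : G)⁻¹ * (b * (a * x * z₃) * (z₂ * z₄)) := by
  have h₁ : z₄ * (z₁ * z₃) = z₃ * (z₂ * z₄) * (z₁ * z₂⁻¹) := by
    have : ∀ y₁ y₂ y₃ y₄ : Additive (Subgroup.center G),
      y₄ + (y₁ + y₃) = y₃ + (y₂ + y₄) + (y₁ + -y₂) := fun _ _ _ _ => by abel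
    exact this z₁ z₂ z₃ z₄
  have h₂ := congrArg (Subgroup.center G).subtype h₁
  have h₃ := Subgroup.mem_center_iff.1 (z₁ * z₂⁻¹).2 (b * (a * x * z₃) * (z₂ * z₄))
  simp only [map_mul, map_inv, Subgroup.coe_subtype, Subgroup.coe_mul, Subgroup.coe_inv] at h₂ h₃
  calc a * (b * x * z₄) * (z₁ * z₃) = a * b * x * (z₄ * (z₁ * z₃)) := by simp only [mul_assoc]
    _ = ⁅a, b⁆ * (b * (a * x * z₃) * (z₂ * z₄) * (z₁ * (z₂ : G)⁻¹)) := by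
      rw [h₂, commutatorElement_def]; group
    _ = _ := by rw [h₃]; simp only [mul_assoc]

/-- Two twisted permutations commute up to a central translation. -/
theorem IsTwisted.exists_commutator {ω ω' : Equiv.Perm (ℕ → G)} (h : IsTwisted ω)
    (h' : IsTwisted ω') (hG : ∀ a b : G, ⁅a, b⁆ ∈ Subgroup.center G) :
    ∃ z, ∀ x, ω (ω' x) = centralSeq G z * ω' (ω x) := by
  obtain ⟨r, c, hc, h⟩ := h
  obtain ⟨r', c', hc', h'⟩ := h'
  refine ⟨(fun n => ⟨⁅r n, r' n⁆, hG _ _⟩) * c r' * (c' r)⁻¹, fun x => ?_⟩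
  rw [h, h', h', h]
  simp only [map_mul, hc, hc', mul_one]
  funext n
  simp only [Pi.mul_apply, MonoidHom.compLeft_apply, Function.comp_apply, map_inv,
    Subgroup.coe_subtype, Pi.inv_apply]
  exact swap_mod_center _ _ _ _ _ _ _

variable {V : Type v} [CommGroup V] (f : G →* V)

/-- Class at most two is encoded by a homomorphism `f` to an abelian group whose kernel is the
centre. -/
theorem commutator_mem_center (hf : f.ker = Subgroup.center G) (a b : G) :
    ⁅a, b⁆ ∈ Subgroup.center G := by
  rw [← hf, MonoidHom.mem_ker, map_commutatorElement, commutatorElement_eq_one_iff_mul_comm]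
  exact mul_comm _ _

theorem exists_eq_mul_centralSeq (hf : f.ker = Subgroup.center G) {x y : ℕ → G}
    (h : f.compLeft ℕ x = f.compLeft ℕ y) : ∃ z, y = x * centralSeq G z := by
  refine ⟨fun n => ⟨(x n)⁻¹ * y n, ?_⟩, funext fun n => by simp⟩
  rw [← hf, MonoidHom.mem_ker, map_mul, map_inv, inv_mul_eq_one]
  exact congrFun h n

theorem eq_of_compLeft_eq (hf : f.ker = Subgroup.center G) {K : Type*} [Group K]
    (c : (ℕ → G) →* K) (hc : ∀ z, c (centralSeq G z) = 1) {x y : ℕ → G}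
    (h : f.compLeft ℕ x = f.compLeft ℕ y) : c x = c y := by
  obtain ⟨z, rfl⟩ := exists_eq_mul_centralSeq f hf h
  rw [map_mul, hc, mul_one]

/-- Composition of a homomorphism that kills the central sequences with a map that induces a
homomorphism modulo the centre. -/
def compModCenter (hf : f.ker = Subgroup.center G) {K : Type*} [Group K]
    (c : (ℕ → G) →* K) (hc : ∀ z, c (centralSeq G z) = 1) (σ : (ℕ → G) → (ℕ → G))
    (τ : (ℕ → V) → (ℕ → V)) (hτ : ∀ x y, τ (x * y) = τ x * τ y)
    (hσ : ∀ x, f.compLeft ℕ (σ x) = τ (f.compLeft ℕ x)) : (ℕ → G) →* K :=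
  MonoidHom.mk' (fun x => c (σ x)) fun x y => by
    rw [← map_mul]
    apply eq_of_compLeft_eq f hf c hc
    rw [hσ, map_mul, hτ, map_mul, hσ, hσ]

theorem compModCenter_apply (hf : f.ker = Subgroup.center G) {K : Type*} [Group K]
    (c : (ℕ → G) →* K) (hc : ∀ z, c (centralSeq G z) = 1) (σ : (ℕ → G) → (ℕ → G))
    (τ : (ℕ → V) → (ℕ → V)) (hτ : ∀ x y, τ (x * y) = τ x * τ y)
    (hσ : ∀ x, f.compLeft ℕ (σ x) = τ (f.compLeft ℕ x)) (x : ℕ → G) :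
    compModCenter f hf c hc σ τ hτ hσ x = c (σ x) := rfl

theorem compModCenter_centralSeq (hf : f.ker = Subgroup.center G) {K : Type*} [Group K]
    (c : (ℕ → G) →* K) (hc : ∀ z, c (centralSeq G z) = 1) (σ : (ℕ → G) → (ℕ → G))
    (τ : (ℕ → V) → (ℕ → V)) (hτ : ∀ x y, τ (x * y) = τ x * τ y)
    (hσ : ∀ x, f.compLeft ℕ (σ x) = τ (f.compLeft ℕ x)) (z : ℕ → Subgroup.center G) :
    compModCenter f hf c hc σ τ hτ hσ (centralSeq G z) = 1 := by
  rw [← map_one (compModCenter f hf c hc σ τ hτ hσ)]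
  simp only [compModCenter_apply]
  apply eq_of_compLeft_eq f hf c hc
  rw [hσ, hσ, map_one]
  congr 1
  funext n
  have : (z n : G) ∈ f.ker := by rw [hf]; exact (z n).2
  exact this

/-- The correction terms in `prods (r * quots x)`. -/
def prodsCorrection (hG : ∀ a b : G, ⁅a, b⁆ ∈ Subgroup.center G) (r : ℕ → G) :
    (ℕ → G) →* (ℕ → Subgroup.center G) :=
  MonoidHom.mk' (fun x => prods fun
    | 0 => 1
    | n + 1 => commutatorHom hG (r (n + 1))⁻¹ (x n)) fun x y => by
      refine Eq.trans ?_ (prods_mul _ _)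
      congr 1
      funext n
      cases n <;> simp

/-- In each new factor, `r (n + 1)` is conjugated by `x n`, which costs a central commutator that is
multiplicative in `x n`. These costs accumulate as prefix products. -/
theorem prods_mul_quots (hG : ∀ a b : G, ⁅a, b⁆ ∈ Subgroup.center G) (r x : ℕ → G) :
    prods (r * quots x) = prods r * x * centralSeq G (prodsCorrection hG r x) := by
  funext n
  induction n with
  | zero => simp [prods, quots, prodsCorrection]
  | succ n ih =>
    have e := Subgroup.mem_center_iff.1 (prodsCorrection hG r x n).2
    rw [prods, ih]
    have e1 : ((prodsCorrection hG r x (n + 1) : Subgroup.center G) : G) =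
      prodsCorrection hG r x n * ⁅(r (n + 1))⁻¹, x n⁆ := rfl
    simp only [Pi.mul_apply, MonoidHom.compLeft_apply, Function.comp_apply,
      Subgroup.coe_subtype, e1]
    generalize ((prodsCorrection hG r x n : Subgroup.center G) : G) = z at *
    have e2 := Subgroup.mem_center_iff.1 (hG (r (n + 1))⁻¹ (x n)) (x (n + 1))
    rw [e, mul_assoc z, ← mul_assoc _ z, e, mul_assoc z, mul_assoc _ (x (n + 1)), e2,
      commutatorElement_def]
    simp only [prods, quots]
    group

/-- The correction terms in `quots (r * prods x)`. -/
def quotsCorrection (hG : ∀ a b : G, ⁅a, b⁆ ∈ Subgroup.center G) (r : ℕ → G) :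
    (ℕ → G) →* (ℕ → Subgroup.center G) :=
  MonoidHom.mk' (fun x => fun
    | 0 => 1
    | n + 1 => commutatorHom hG (quots r (n + 1))⁻¹ (x n)⁻¹) fun x y => by
      funext n
      cases n
      · simp
      · simp [mul_comm (commutatorHom hG _ (y _))⁻¹]

/-- Here `quots r (n + 1)` is conjugated by the inverse of `prods x n`, and the commutators do not
accumulate. -/
theorem quots_mul_prods (hG : ∀ a b : G, ⁅a, b⁆ ∈ Subgroup.center G) (r x : ℕ → G) :
    quots (r * prods x) = quots r * x * centralSeq G (quotsCorrection hG r (prods x)) := by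
  funext n
  cases n with
  | zero => simp [prods, quots, quotsCorrection]
  | succ n =>
    have e1 : ((quotsCorrection hG r (prods x) (n + 1) : Subgroup.center G) : G) =
      ⁅(quots r (n + 1))⁻¹, (prods x n)⁻¹⁆ := rfl
    simp only [Pi.mul_apply, MonoidHom.compLeft_apply, Function.comp_apply,
      Subgroup.coe_subtype, e1]
    have e2 := Subgroup.mem_center_iff.1 (hG (quots r (n + 1))⁻¹ (prods x n)⁻¹) (x (n + 1))
    rw [mul_assoc, e2, commutatorElement_def]
    simp only [quots, prods, Pi.mul_apply]
    group

/-- Although `quots` is not multiplicative on sequences over `G`, it is so modulo the centre, and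
that is all the old correction `c` sees. So `c` after `quots` is again a homomorphism, to which
`prodsCorrection` is added. -/
theorem IsTwisted.conj_perm (hf : f.ker = Subgroup.center G) {ω : Equiv.Perm (ℕ → G)}
    (h : IsTwisted ω) : IsTwisted (perm G * ω * (perm G)⁻¹) := by
  obtain ⟨r, c, hc, h⟩ := h
  have hG := commutator_mem_center f hf
  have hq : ∀ x, f.compLeft ℕ (quots x) = quots (f.compLeft ℕ x) := fun x => (quots_map f x).symm
  let c' := compModCenter f hf c hc quots quots quots_mul hq
  let P : (ℕ → Subgroup.center G) →* (ℕ → Subgroup.center G) := MonoidHom.mk' prods fun _ _ => prods_mul _ _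
  refine ⟨prods r, prodsCorrection hG r * P.comp c', fun z => ?_, fun x => ?_⟩
  · rw [MonoidHom.mul_apply, MonoidHom.comp_apply, compModCenter_centralSeq, map_one, mul_one]
    have : (fun | 0 => 1
                | n + 1 => commutatorHom hG (r (n + 1))⁻¹ (z n) : ℕ → Subgroup.center G) = 1 := by
      funext n
      cases n with
      | zero => rfl
      | succ n => exact commutatorHom_center hG _ _
    exact (congrArg P this).trans (map_one P)
  · rw [Equiv.Perm.mul_apply, Equiv.Perm.mul_apply, h, perm_inv_apply, perm_apply,
      centralSeq_comm, prods_centralSeq_mul, prods_mul_quots hG, ← centralSeq_comm, mul_assoc,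
      ← map_mul]
    rfl

theorem IsTwisted.conj_perm_inv (hf : f.ker = Subgroup.center G) {ω : Equiv.Perm (ℕ → G)}
    (h : IsTwisted ω) : IsTwisted ((perm G)⁻¹ * ω * perm G) := by
  obtain ⟨r, c, hc, h⟩ := h
  have hG := commutator_mem_center f hf
  have hq : ∀ x, f.compLeft ℕ (prods x) = prods (f.compLeft ℕ x) := fun x => (prods_map f x).symm
  have hr : ∀ z, quotsCorrection hG r (centralSeq G z) = 1 := by
    intro z
    funext n
    cases n with
    | zero => rfl
    | succ n => exact commutatorHom_center hG (quots r (n + 1))⁻¹ (z n)⁻¹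
  let c' := compModCenter f hf c hc prods prods prods_mul hq
  let c'' := compModCenter f hf _ hr prods prods prods_mul hq
  let P : (ℕ → Subgroup.center G) →* (ℕ → Subgroup.center G) := MonoidHom.mk' quots fun _ _ => quots_mul _ _
  refine ⟨quots r, c'' * P.comp c', fun z => ?_, fun x => ?_⟩
  · rw [MonoidHom.mul_apply, MonoidHom.comp_apply, compModCenter_centralSeq,
      compModCenter_centralSeq, map_one, mul_one]
  · have hz : ∀ (z : ℕ → Subgroup.center G) (x : ℕ → G),
        quots (centralSeq G z * x) = centralSeq G (quots z) * quots x := fun z x => by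
      simpa using perm_zpow_centralSeq_mul (-1) z x
    rw [Equiv.Perm.mul_apply, Equiv.Perm.mul_apply, h, perm_inv_apply, perm_apply,
      centralSeq_comm, hz, quots_mul_prods hG, ← centralSeq_comm, mul_assoc, ← map_mul]
    rfl

theorem IsTwisted.conj_perm_zpow (hf : f.ker = Subgroup.center G) {ω : Equiv.Perm (ℕ → G)}
    (h : IsTwisted ω) (k : ℤ) : IsTwisted (perm G ^ k * ω * (perm G ^ k)⁻¹) := by
  induction k with
  | zero => simpa using h
  | succ n ih =>
    have := ih.conj_perm f hf
    convert this using 1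
    group
  | pred n ih =>
    have := ih.conj_perm_inv f hf
    convert this using 1
    group

end Central

end PrefixProduct

/-! ### Layers: conjugates of the constant translations, and their commutators -/

namespace PrefixProduct

open scoped commutatorElement IsMulCommutative

section Layers

variable {G : Type u} [Group G] {Γ : Type u} [Group Γ] (t : Γ) (L : G →* Γ)

/-- The `k`-th conjugate of a homomorphism by `t`. -/
def layer (k : ℤ) : G →* Γ := (MulAut.conj (t ^ k)).toMonoidHom.comp L

theorem layer_apply (k : ℤ) (g : G) : layer t L k g = t ^ k * L g * (t ^ k)⁻¹ := rfl

theorem conj_layer (j k : ℤ) (g : G) :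
    t ^ j * layer t L k g * (t ^ j)⁻¹ = layer t L (j + k) g := by
  simp only [layer_apply]; group

/-- The subgroup generated by the layers with index in `I`. -/
def layers (I : Set ℤ) : Subgroup Γ := Subgroup.closure {x | ∃ k ∈ I, ∃ g, x = layer t L k g}

/-- The subgroup generated by the central elements of the layers with index in `I`. -/
def centralLayers (I : Set ℤ) : Subgroup Γ :=
  Subgroup.closure {x | ∃ k ∈ I, ∃ z : Subgroup.center G, x = layer t L k z}

variable {t L}

theorem layer_mem_layers {I : Set ℤ} {k : ℤ} (hk : k ∈ I) (g : G) : layer t L k g ∈ layers t L I :=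
  Subgroup.subset_closure ⟨k, hk, g, rfl⟩

theorem layer_mem_centralLayers {I : Set ℤ} {k : ℤ} (hk : k ∈ I) (z : Subgroup.center G) :
    layer t L k z ∈ centralLayers t L I :=
  Subgroup.subset_closure ⟨k, hk, z, rfl⟩

theorem layers_mono {I J : Set ℤ} (h : I ⊆ J) : layers t L I ≤ layers t L J := by
  refine Subgroup.closure_mono ?_
  rintro _ ⟨k, hk, g, rfl⟩
  exact ⟨k, h hk, g, rfl⟩

theorem centralLayers_mono {I J : Set ℤ} (h : I ⊆ J) :
    centralLayers t L I ≤ centralLayers t L J := by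
  refine Subgroup.closure_mono ?_
  rintro _ ⟨k, hk, g, rfl⟩
  exact ⟨k, h hk, g, rfl⟩

theorem centralLayers_le_layers (I : Set ℤ) : centralLayers t L I ≤ layers t L I := by
  refine Subgroup.closure_mono ?_
  rintro _ ⟨k, hk, g, rfl⟩
  exact ⟨k, hk, g, rfl⟩

theorem layers_singleton (k : ℤ) : layers t L {k} = (layer t L k).range := by
  apply le_antisymm
  · rw [layers, Subgroup.closure_le]
    rintro _ ⟨_, rfl, g, rfl⟩
    exact ⟨g, rfl⟩
  · rintro _ ⟨g, rfl⟩
    exact layer_mem_layers (Set.mem_singleton k) g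

theorem conj_mem_layers {I J : Set ℤ} {j : ℤ} (h : ∀ k ∈ I, j + k ∈ J) {x : Γ}
    (hx : x ∈ layers t L I) : t ^ j * x * (t ^ j)⁻¹ ∈ layers t L J := by
  have : layers t L I ≤ (layers t L J).comap (MulAut.conj (t ^ j)).toMonoidHom := by
    rw [layers, Subgroup.closure_le]
    rintro _ ⟨k, hk, g, rfl⟩
    change t ^ j * layer t L k g * (t ^ j)⁻¹ ∈ layers t L J
    rw [conj_layer]
    exact layer_mem_layers (h k hk) g
  exact this hx

theorem conj_mem_centralLayers {I J : Set ℤ} {j : ℤ} (h : ∀ k ∈ I, j + k ∈ J) {x : Γ}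
    (hx : x ∈ centralLayers t L I) : t ^ j * x * (t ^ j)⁻¹ ∈ centralLayers t L J := by
  have : centralLayers t L I ≤ (centralLayers t L J).comap (MulAut.conj (t ^ j)).toMonoidHom := by
    rw [centralLayers, Subgroup.closure_le]
    rintro _ ⟨k, hk, g, rfl⟩
    change t ^ j * layer t L k g * (t ^ j)⁻¹ ∈ centralLayers t L J
    rw [conj_layer]
    exact layer_mem_centralLayers (h k hk) g
  exact this hx

theorem exists_mem_layers_Ici {n : Γ} (hn : n ∈ layers t L Set.univ) :
    ∃ k, n ∈ layers t L (Set.Ici k) := by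
  induction hn using Subgroup.closure_induction with
  | mem x hx =>
    obtain ⟨k, -, g, rfl⟩ := hx
    exact ⟨k, layer_mem_layers (Set.mem_Ici.2 le_rfl) g⟩
  | one => exact ⟨0, one_mem _⟩
  | mul x y _ _ hx hy =>
    obtain ⟨j, hj⟩ := hx
    obtain ⟨k, hk⟩ := hy
    exact ⟨min j k, mul_mem (layers_mono (Set.Ici_subset_Ici.2 (min_le_left j k)) hj)
      (layers_mono (Set.Ici_subset_Ici.2 (min_le_right j k)) hk)⟩
  | inv x _ hx =>
    obtain ⟨j, hj⟩ := hx
    exact ⟨j, inv_mem hj⟩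

theorem exists_mem_layers_Iio {n : Γ} (hn : n ∈ layers t L Set.univ) :
    ∃ k, n ∈ layers t L (Set.Iio k) := by
  induction hn using Subgroup.closure_induction with
  | mem x hx =>
    obtain ⟨k, -, g, rfl⟩ := hx
    exact ⟨k + 1, layer_mem_layers (Set.mem_Iio.2 (lt_add_one k)) g⟩
  | one => exact ⟨0, one_mem _⟩
  | mul x y _ _ hx hy =>
    obtain ⟨j, hj⟩ := hx
    obtain ⟨k, hk⟩ := hy
    exact ⟨max j k, mul_mem (layers_mono (Set.Iio_subset_Iio (le_max_left j k)) hj)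
      (layers_mono (Set.Iio_subset_Iio (le_max_right j k)) hk)⟩
  | inv x _ hx =>
    obtain ⟨j, hj⟩ := hx
    exact ⟨j, inv_mem hj⟩

variable {act : Γ →* Equiv.Perm (ℕ → G)}

theorem act_layer (ht : act t = perm G) (k : ℤ) (g : G) :
    act (layer t L k g) = perm G ^ k * act (L g) * (perm G ^ k)⁻¹ := by
  rw [layer_apply, map_mul, map_mul, map_inv, map_zpow, ht]

theorem act_layer_apply (ht : act t = perm G)
    (hL : ∀ g x, act (L g) x = Function.const ℕ g * x) (k : ℤ) (g : G) (x : ℕ → G) :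
    act (layer t L k g) x = (perm G ^ k) (Function.const ℕ g * (perm G ^ (-k)) x) := by
  rw [act_layer ht, Equiv.Perm.mul_apply, Equiv.Perm.mul_apply, hL, zpow_neg]

theorem isTwisted_act_layer {V : Type v} [CommGroup V] (f : G →* V)
    (hf : f.ker = Subgroup.center G) (ht : act t = perm G)
    (hL : ∀ g x, act (L g) x = Function.const ℕ g * x) (k : ℤ) (g : G) :
    IsTwisted (act (layer t L k g)) := by
  rw [act_layer ht]
  refine IsTwisted.conj_perm_zpow f hf ⟨Function.const ℕ g, 1, fun _ => rfl, fun x => ?_⟩ k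
  rw [hL]
  simp

theorem perm_zpow_cancel {H : Type u} [Group H] (k : ℤ) (x : ℕ → H) :
    (perm H ^ k) ((perm H ^ (-k)) x) = x := by
  rw [← Equiv.Perm.mul_apply, ← zpow_add, add_neg_cancel, zpow_zero, Equiv.Perm.one_apply]

/-- Powers of `t` transform a central translation in the same way whatever sequence it is applied
to, and constant translations commute with it. In a layer the transformations by `t ^ (-k)` and `t ^
k` cancel. -/
theorem act_centralSeq_mul (ht : act t = perm G)
    (hL : ∀ g x, act (L g) x = Function.const ℕ g * x) {I : Set ℤ} {n : Γ}
    (hn : n ∈ layers t L I) (z : ℕ → Subgroup.center G) (x : ℕ → G) :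
    act n (centralSeq G z * x) = centralSeq G z * act n x := by
  induction hn using Subgroup.closure_induction generalizing x with
  | mem n hn =>
    obtain ⟨k, -, g, rfl⟩ := hn
    rw [act_layer_apply ht hL, act_layer_apply ht hL, perm_zpow_centralSeq_mul, ← mul_assoc,
      centralSeq_comm, mul_assoc, perm_zpow_centralSeq_mul, perm_zpow_cancel]
  | one => simp
  | mul n m _ _ hn hm => rw [map_mul act n m, Equiv.Perm.mul_apply, Equiv.Perm.mul_apply, hm, hn]
  | inv n _ hn =>
    rw [map_inv, Equiv.Perm.inv_eq_iff_eq, hn]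
    exact congrArg _ ((act n).apply_symm_apply x).symm

theorem act_layer_center (ht : act t = perm G)
    (hL : ∀ g x, act (L g) x = Function.const ℕ g * x) (k : ℤ) (z : Subgroup.center G)
    (x : ℕ → G) : act (layer t L k z) x = centralSeq G (iter k z) * x := by
  rw [act_layer_apply ht hL, show Function.const ℕ (z : G) = centralSeq G (Function.const ℕ z) from
    rfl, perm_zpow_centralSeq_mul, perm_zpow_cancel]
  rfl

theorem exists_act_centralLayers (ht : act t = perm G)
    (hL : ∀ g x, act (L g) x = Function.const ℕ g * x) {I : Set ℤ} {w : Γ}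
    (hw : w ∈ centralLayers t L I) :
    ∃ c ∈ span (Subgroup.center G) I, ∀ x, act w x = centralSeq G c * x := by
  induction hw using Subgroup.closure_induction with
  | mem w hw =>
    obtain ⟨k, hk, z, rfl⟩ := hw
    exact ⟨_, iter_mem_span hk z, act_layer_center ht hL k z⟩
  | one => exact ⟨1, one_mem _, by simp⟩
  | mul w w' _ _ h h' =>
    obtain ⟨c, hc, h⟩ := h
    obtain ⟨c', hc', h'⟩ := h'
    refine ⟨c * c', mul_mem hc hc', fun x => ?_⟩
    rw [map_mul, Equiv.Perm.mul_apply, h', h, map_mul, mul_assoc]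
  | inv w _ h =>
    obtain ⟨c, hc, h⟩ := h
    refine ⟨c⁻¹, inv_mem hc, fun x => ?_⟩
    rw [map_inv, Equiv.Perm.inv_eq_iff_eq, h, map_inv, mul_inv_cancel_left]

theorem exists_centralLayers_act (ht : act t = perm G)
    (hL : ∀ g x, act (L g) x = Function.const ℕ g * x) {I : Set ℤ}
    {c : ℕ → Subgroup.center G} (hc : c ∈ span (Subgroup.center G) I) :
    ∃ w ∈ centralLayers t L I, ∀ x, act w x = centralSeq G c * x := by
  induction hc using Subgroup.closure_induction with
  | mem c hc =>
    obtain ⟨k, hk, z, rfl⟩ := hc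
    exact ⟨_, layer_mem_centralLayers hk z, act_layer_center ht hL k z⟩
  | one => exact ⟨1, one_mem _, by simp⟩
  | mul c c' _ _ h h' =>
    obtain ⟨w, hw, h⟩ := h
    obtain ⟨w', hw', h'⟩ := h'
    refine ⟨w * w', mul_mem hw hw', fun x => ?_⟩
    rw [map_mul, Equiv.Perm.mul_apply, h', h, map_mul, mul_assoc]
  | inv c _ h =>
    obtain ⟨w, hw, h⟩ := h
    refine ⟨w⁻¹, inv_mem hw, fun x => ?_⟩
    rw [map_inv, Equiv.Perm.inv_eq_iff_eq, h, map_inv, mul_inv_cancel_left]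

theorem mem_centralLayers_of_act (hact : Function.Injective act) (ht : act t = perm G)
    (hL : ∀ g x, act (L g) x = Function.const ℕ g * x) {I : Set ℤ}
    {c : ℕ → Subgroup.center G} (hc : c ∈ span (Subgroup.center G) I) {w : Γ}
    (hw : ∀ x, act w x = centralSeq G c * x) : w ∈ centralLayers t L I := by
  obtain ⟨w', hw', h⟩ := exists_centralLayers_act ht hL hc
  rwa [hact (Equiv.ext fun x => (hw x).trans (h x).symm)]

theorem layers_comm_centralLayers (hact : Function.Injective act) (ht : act t = perm G)
    (hL : ∀ g x, act (L g) x = Function.const ℕ g * x) {I J : Set ℤ} {n w : Γ}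
    (hn : n ∈ layers t L I) (hw : w ∈ centralLayers t L J) : n * w = w * n := by
  obtain ⟨c, -, h⟩ := exists_act_centralLayers ht hL hw
  refine hact (Equiv.ext fun x => ?_)
  rw [map_mul, map_mul, Equiv.Perm.mul_apply, Equiv.Perm.mul_apply, h, h,
    act_centralSeq_mul ht hL hn]

/-- The layers of negative index move only finitely many letters. -/
theorem act_layer_neg_apply (ht : act t = perm G)
    (hL : ∀ g x, act (L g) x = Function.const ℕ g * x) (m : ℕ) (g : G) (x : ℕ → G) (i : ℕ)
    (hi : m < i) : act (layer t L (-(m + 1 : ℤ)) g) x i = x i := by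
  -- A common left factor cancels in successive quotients, except at position `0`. Each further
  -- conjugation by `t⁻¹` lets a change spread by at most one position.
  have hstep : ∀ (k : ℤ) (x : ℕ → G),
      act (layer t L (k - 1) g) x = quots (act (layer t L k g) (prods x)) := by
    intro k x
    have : layer t L (k - 1) g = t⁻¹ * layer t L k g * t := by
      rw [show k - 1 = -1 + k by ring, ← conj_layer]; simp
    rw [this, map_mul, map_mul, map_inv, ht]
    rfl
  induction m generalizing x i with
  | zero =>
    obtain ⟨i, rfl⟩ := Nat.exists_eq_succ_of_ne_zero hi.ne'
    rw [show (-((0 : ℕ) + 1 : ℤ)) = 0 - 1 by simp, hstep]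
    have : layer t L 0 g = L g := by simp [layer_apply]
    rw [this, hL]
    simp [quots, prods, mul_assoc]
  | succ m ih =>
    obtain ⟨i, rfl⟩ := Nat.exists_eq_succ_of_ne_zero (Nat.ne_zero_of_lt hi)
    rw [show (-((m + 1 : ℕ) + 1 : ℤ)) = -(m + 1 : ℤ) - 1 by push_cast; ring, hstep, quots,
      ih _ i (by omega), ih _ (i + 1) (by omega)]
    simp [prods]

theorem commutator_layer_mem_of_lt {V : Type v} [CommGroup V] (f : G →* V)
    (hf : f.ker = Subgroup.center G) (hact : Function.Injective act) (ht : act t = perm G)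
    (hL : ∀ g x, act (L g) x = Function.const ℕ g * x) {j k : ℤ} (hjk : j < k) (g h : G) :
    ⁅layer t L j g, layer t L k h⁆ ∈ centralLayers t L (Set.Ico j k) := by
  obtain ⟨m, hm⟩ := Int.eq_ofNat_of_zero_le (show 0 ≤ k - j - 1 by omega)
  -- Since `m = k - j - 1`, conjugation by `t ^ k` carries the indices `-(m + 1)` and `0` to `j` and
  -- `k`. The commutator is translation by some central `z`; as the lower layer fixes letters beyond
  -- position `m`, `z` is trivial there.
  have key : ⁅layer t L (-(m + 1 : ℤ)) g, layer t L 0 h⁆ ∈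
      centralLayers t L (Set.Ico (-(m + 1 : ℕ) : ℤ) 0) := by
    obtain ⟨z, hz⟩ := (isTwisted_act_layer f hf ht hL (-(m + 1 : ℤ)) g).exists_commutator
      (isTwisted_act_layer f hf ht hL 0 h) (commutator_mem_center f hf)
    refine mem_centralLayers_of_act hact ht hL (mem_span_of_finite_support (m + 1) z ?_)
      (c := z) fun x => ?_
    · intro i hi
      have h0 : ∀ x, act (layer t L 0 h) x = Function.const ℕ h * x := fun x => by
        rw [show layer t L 0 h = L h by simp [layer_apply], hL]
      have h1 := congrFun (hz 1) i
      rw [h0, h0, act_layer_neg_apply ht hL m g _ i hi, Pi.mul_apply, Pi.mul_apply, Pi.mul_apply,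
        act_layer_neg_apply ht hL m g _ i hi] at h1
      exact Subtype.ext (mul_eq_right.1 h1.symm)
    · have h1 := hz ((act (layer t L (-(m + 1 : ℤ)) g))⁻¹ ((act (layer t L 0 h))⁻¹ x))
      rw [commutatorElement_def, map_mul, map_mul, map_mul, map_inv, map_inv]
      simp only [Equiv.Perm.mul_apply]
      rw [h1]
      congr 1
      refine (congrArg (act (layer t L 0 h)) ((act _).apply_symm_apply _)).trans ?_
      exact (act _).apply_symm_apply _
  have h1 := conj_mem_centralLayers (j := k) (J := Set.Ico j k) (fun i hi => by
    simp only [Set.mem_Ico] at hi ⊢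
    push_cast at hi
    omega) key
  have h2 : t ^ k * ⁅layer t L (-(m + 1 : ℤ)) g, layer t L 0 h⁆ * (t ^ k)⁻¹ =
      ⁅layer t L j g, layer t L k h⁆ := by
    rw [conjugate_commutatorElement, conj_layer, conj_layer, add_zero,
      show k + -(m + 1 : ℤ) = j by omega]
  rwa [h2] at h1

/-- Order-connectedness of `I` matters because the commutator may spread over the indices between
`j` and `k`. -/
theorem commutator_layer_mem {V : Type v} [CommGroup V] (f : G →* V)
    (hf : f.ker = Subgroup.center G) (hact : Function.Injective act) (ht : act t = perm G)
    (hL : ∀ g x, act (L g) x = Function.const ℕ g * x) {I : Set ℤ} (hI : I.OrdConnected)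
    {j k : ℤ} (hj : j ∈ I) (hk : k ∈ I) (g h : G) :
    ⁅layer t L j g, layer t L k h⁆ ∈ centralLayers t L I := by
  rcases lt_trichotomy j k with hjk | rfl | hjk
  · exact centralLayers_mono (Set.Ico_subset_Icc_self.trans (hI.out hj hk))
      (commutator_layer_mem_of_lt f hf hact ht hL hjk g h)
  · rw [← map_commutatorElement]
    exact layer_mem_centralLayers hj ⟨_, commutator_mem_center f hf g h⟩
  · rw [← commutatorElement_inv]
    exact inv_mem (centralLayers_mono (Set.Ico_subset_Icc_self.trans (hI.out hk hj))
      (commutator_layer_mem_of_lt f hf hact ht hL hjk h g))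

end Layers

end PrefixProduct

/-! ### Intersections and factorizations of the groups of layers -/

namespace PrefixProduct

open scoped commutatorElement IsMulCommutative

section Structure

variable {G : Type u} [Group G] {Γ : Type u} [Group Γ] {t : Γ} {L : G →* Γ}
  {act : Γ →* Equiv.Perm (ℕ → G)} {V : Type v} [CommGroup V] (f : G →* V)

theorem map_act_layer (ht : act t = perm G)
    (hL : ∀ g x, act (L g) x = Function.const ℕ g * x) (k : ℤ) (g : G) (x : ℕ → G) :
    f.compLeft ℕ (act (layer t L k g) x) = iter k (f g) * f.compLeft ℕ x := by
  rw [act_layer_apply ht hL, perm_zpow_map, map_mul, perm_zpow_mul, perm_zpow_map,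
    perm_zpow_cancel]
  rfl

theorem exists_mem_layers_map_act (hf' : Function.Surjective f) (ht : act t = perm G)
    (hL : ∀ g x, act (L g) x = Function.const ℕ g * x) {I : Set ℤ} {v : ℕ → V}
    (hv : v ∈ span V I) :
    ∃ n ∈ layers t L I, ∀ x, f.compLeft ℕ (act n x) = v * f.compLeft ℕ x := by
  induction hv using Subgroup.closure_induction with
  | mem v hv =>
    obtain ⟨k, hk, h, rfl⟩ := hv
    obtain ⟨g, rfl⟩ := hf' h
    exact ⟨_, layer_mem_layers hk g, map_act_layer f ht hL k g⟩
  | one => exact ⟨1, one_mem _, by simp⟩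
  | mul v v' _ _ h h' =>
    obtain ⟨n, hn, h⟩ := h
    obtain ⟨n', hn', h'⟩ := h'
    refine ⟨n * n', mul_mem hn hn', fun x => ?_⟩
    rw [map_mul act, Equiv.Perm.mul_apply, h, h', mul_assoc]
  | inv v _ h =>
    obtain ⟨n, hn, h⟩ := h
    refine ⟨n⁻¹, inv_mem hn, fun x => ?_⟩
    rw [eq_inv_mul_iff_mul_eq, ← h, map_inv act, ← Equiv.Perm.mul_apply, mul_inv_cancel,
      Equiv.Perm.one_apply]

/-- The central layers commute with all layers, so commutators lying in them are multiplicative in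
each argument and it suffices to treat generators. -/
theorem commutator_mem_centralLayers (hf : f.ker = Subgroup.center G)
    (hact : Function.Injective act) (ht : act t = perm G)
    (hL : ∀ g x, act (L g) x = Function.const ℕ g * x) {I : Set ℤ} (hI : I.OrdConnected)
    {n m : Γ} (hn : n ∈ layers t L I) (hm : m ∈ layers t L I) :
    ⁅n, m⁆ ∈ centralLayers t L I := by
  have hconj : ∀ x ∈ layers t L I, ∀ w ∈ centralLayers t L I, x * w * x⁻¹ = w := by
    intro x hx w hw
    rw [layers_comm_centralLayers hact ht hL hx hw, mul_inv_cancel_right]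
  have hmul : ∀ x ∈ layers t L I, ∀ y ∈ layers t L I, ∀ z ∈ layers t L I,
      ⁅x, z⁆ ∈ centralLayers t L I → ⁅y, z⁆ ∈ centralLayers t L I →
        ⁅x * y, z⁆ ∈ centralLayers t L I := by
    intro x hx y _ z _ h1 h2
    have : ⁅x * y, z⁆ = x * ⁅y, z⁆ * x⁻¹ * ⁅x, z⁆ := by simp only [commutatorElement_def]; group
    rw [this, hconj x hx _ h2]
    exact mul_mem h2 h1
  have hinv : ∀ x ∈ layers t L I, ∀ z ∈ layers t L I,
      ⁅x, z⁆ ∈ centralLayers t L I → ⁅x⁻¹, z⁆ ∈ centralLayers t L I := by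
    intro x hx z _ h
    have : ⁅x⁻¹, z⁆ = x⁻¹ * ⁅x, z⁆⁻¹ * x⁻¹⁻¹ := by simp only [commutatorElement_def]; group
    rw [this, hconj _ (inv_mem hx) _ (inv_mem h)]
    exact inv_mem h
  have hsymm : ∀ x z, ⁅x, z⁆ ∈ centralLayers t L I → ⁅z, x⁆ ∈ centralLayers t L I := by
    intro x z h
    rw [← commutatorElement_inv]
    exact inv_mem h
  have key : ∀ j ∈ I, ∀ g, ⁅layer t L j g, m⁆ ∈ centralLayers t L I := by
    intro j hj g
    have hg := layer_mem_layers (t := t) (L := L) hj g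
    induction hm using Subgroup.closure_induction with
    | mem m hm =>
      obtain ⟨k, hk, h, rfl⟩ := hm
      exact commutator_layer_mem f hf hact ht hL hI hj hk g h
    | one => rw [commutatorElement_one_right]; exact one_mem _
    | mul x y hx hy h1 h2 => exact hsymm _ _ (hmul x hx y hy _ hg (hsymm _ _ h1) (hsymm _ _ h2))
    | inv x hx h => exact hsymm _ _ (hinv x hx _ hg (hsymm _ _ h))
  induction hn using Subgroup.closure_induction with
  | mem n hn =>
    obtain ⟨j, hj, g, rfl⟩ := hn
    exact key j hj g
  | one => rw [commutatorElement_one_left]; exact one_mem _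
  | mul x y hx hy h1 h2 => exact hmul x hx y hy _ hm h1 h2
  | inv x hx h => exact hinv x hx _ hm h

/-- The elements of the layers in an interval that act trivially modulo the centre are central
translations coming from the same interval. -/
theorem mem_centralLayers_of_map_act (hf : f.ker = Subgroup.center G)
    (hf' : Function.Surjective f) (hact : Function.Injective act) (ht : act t = perm G)
    (hL : ∀ g x, act (L g) x = Function.const ℕ g * x) {I : Set ℤ} (hI : I.OrdConnected)
    {n : Γ} (hn : n ∈ layers t L I) (h : ∀ x, f.compLeft ℕ (act n x) = f.compLeft ℕ x) :
    n ∈ centralLayers t L I := by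
  classical
  let W := (centralLayers t L I).subgroupOf (layers t L I)
  have hW : W.Normal := ⟨fun w hw m => by
    have := layers_comm_centralLayers hact ht hL m.2 (Subgroup.mem_subgroupOf.1 hw)
    rw [show m * w = w * m from Subtype.ext this, mul_inv_cancel_right]
    exact hw⟩
  let cg : CommGroup (layers t L I ⧸ W) :=
    { (inferInstance : Group (layers t L I ⧸ W)) with
      mul_comm := by
        intro a b
        obtain ⟨a, rfl⟩ := QuotientGroup.mk_surjective a
        obtain ⟨b, rfl⟩ := QuotientGroup.mk_surjective b
        rw [← commutatorElement_eq_one_iff_mul_comm]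
        exact (QuotientGroup.eq_one_iff ⁅a, b⁆).2 (Subgroup.mem_subgroupOf.2
          (commutator_mem_centralLayers f hf hact ht hL hI a.2 b.2)) }
  have hlift : ∀ k : ℤ, ∃ ψ : V →* layers t L I ⧸ W, ∀ (hk : k ∈ I) (g : G),
      ψ (f g) = QuotientGroup.mk ⟨layer t L k g, layer_mem_layers hk g⟩ := by
    intro k
    by_cases hk : k ∈ I
    · let θ : G →* layers t L I ⧸ W := (QuotientGroup.mk' W).comp
        ((layer t L k).codRestrict (layers t L I) fun g => layer_mem_layers hk g)
      have hθ : f.ker ≤ θ.ker := by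
        intro g hg
        rw [hf] at hg
        exact (QuotientGroup.eq_one_iff _).2 (Subgroup.mem_subgroupOf.2
          (layer_mem_centralLayers hk ⟨g, hg⟩))
      exact ⟨f.liftOfSurjective hf' ⟨θ, hθ⟩, fun _ g =>
        MonoidHom.liftOfRightInverse_comp_apply f _ (Function.rightInverse_surjInv hf') ⟨θ, hθ⟩ g⟩
    · exact ⟨1, fun hk' => absurd hk' hk⟩
  choose ψ hψ using hlift
  let Λ : (ℤ →₀ Additive V) →+ Additive (layers t L I ⧸ W) :=
    Finsupp.liftAddHom fun k => (ψ k).toAdditive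
  -- One finitely supported family `s` records both the translation induced modulo the centre and
  -- the class of `n` modulo `W`. If the translation is trivial, `total_injective` gives `s = 0`,
  -- whence `n` lies in `W`.
  have key : ∃ s : ℤ →₀ Additive V,
      (∀ x, f.compLeft ℕ (act n x) = (total s).toMul * f.compLeft ℕ x) ∧
        Λ s = Additive.ofMul (QuotientGroup.mk ⟨n, hn⟩) := by
    clear h
    induction hn using Subgroup.closure_induction with
    | mem n hn =>
      obtain ⟨k, hk, g, rfl⟩ := hn
      refine ⟨Finsupp.single k (Additive.ofMul (f g)), fun x => ?_, ?_⟩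
      · rw [total_single, map_act_layer f ht hL]; rfl
      · simp only [Λ, Finsupp.liftAddHom_apply_single]
        exact congrArg Additive.ofMul (hψ k hk g)
    | one =>
      refine ⟨0, fun x => by simp, ?_⟩
      rw [map_zero]
      rfl
    | mul n m hn hm h1 h2 =>
      obtain ⟨s, hs, hs'⟩ := h1
      obtain ⟨r, hr, hr'⟩ := h2
      refine ⟨s + r, fun x => ?_, ?_⟩
      · rw [map_mul act, Equiv.Perm.mul_apply, hs, hr, map_add, toMul_add, mul_assoc]
      · rw [map_add, hs', hr']
        rfl
    | inv n hn h1 =>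
      obtain ⟨s, hs, hs'⟩ := h1
      refine ⟨-s, fun x => ?_, ?_⟩
      · rw [map_neg, toMul_neg, eq_inv_mul_iff_mul_eq, ← hs, map_inv act, ← Equiv.Perm.mul_apply,
          mul_inv_cancel, Equiv.Perm.one_apply]
      · rw [map_neg, hs']
        rfl
  obtain ⟨s, hs, hs'⟩ := key
  have h0 : total s = 0 := by
    have h1 := (hs 1).symm.trans (h 1)
    exact congrArg Additive.ofMul (mul_eq_right.1 h1)
  rw [total_injective (h0.trans (map_zero total).symm), map_zero] at hs'
  exact Subgroup.mem_subgroupOf.1 ((QuotientGroup.eq_one_iff _).1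
    (congrArg Additive.toMul hs'.symm))

theorem exists_span_map_act (ht : act t = perm G)
    (hL : ∀ g x, act (L g) x = Function.const ℕ g * x) {I : Set ℤ} {n : Γ}
    (hn : n ∈ layers t L I) :
    ∃ v ∈ span V I, ∀ x, f.compLeft ℕ (act n x) = v * f.compLeft ℕ x := by
  induction hn using Subgroup.closure_induction with
  | mem n hn =>
    obtain ⟨k, hk, g, rfl⟩ := hn
    exact ⟨_, iter_mem_span hk _, map_act_layer f ht hL k g⟩
  | one => exact ⟨1, one_mem _, by simp⟩
  | mul n n' _ _ h h' =>
    obtain ⟨v, hv, h⟩ := h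
    obtain ⟨v', hv', h'⟩ := h'
    refine ⟨v * v', mul_mem hv hv', fun x => ?_⟩
    rw [map_mul act, Equiv.Perm.mul_apply, h, h', mul_assoc]
  | inv n _ h =>
    obtain ⟨v, hv, h⟩ := h
    refine ⟨v⁻¹, inv_mem hv, fun x => ?_⟩
    rw [eq_inv_mul_iff_mul_eq, ← h, map_inv act, ← Equiv.Perm.mul_apply, mul_inv_cancel,
      Equiv.Perm.one_apply]

/-- Independence is used twice. Over `V` it places the translation induced by `n` in the span of `I
∩ J`, and this lifts to some `m` in those layers. Then `m⁻¹ * n` is a central translation belonging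
to both `I` and `J`, and independence over the centre puts it in `I ∩ J`. -/
theorem layers_inter (hf : f.ker = Subgroup.center G)
    (hf' : Function.Surjective f) (hact : Function.Injective act) (ht : act t = perm G)
    (hL : ∀ g x, act (L g) x = Function.const ℕ g * x) {I J : Set ℤ} (hI : I.OrdConnected)
    (hJ : J.OrdConnected) : layers t L I ⊓ layers t L J = layers t L (I ∩ J) := by
  refine le_antisymm ?_ (le_inf (layers_mono Set.inter_subset_left)
    (layers_mono Set.inter_subset_right))
  rintro n ⟨hnI, hnJ⟩
  obtain ⟨v, hv, h⟩ := exists_span_map_act f ht hL hnI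
  obtain ⟨v', hv', h'⟩ := exists_span_map_act f ht hL hnJ
  obtain rfl : v = v' := mul_right_cancel ((h 1).symm.trans (h' 1))
  obtain ⟨m, hm, hmv⟩ := exists_mem_layers_map_act f hf' ht hL (mem_span_inter hv hv')
  have htriv : ∀ x, f.compLeft ℕ (act (m⁻¹ * n) x) = f.compLeft ℕ x := by
    intro x
    have h1 := hmv (act (m⁻¹ * n) x)
    rw [← Equiv.Perm.mul_apply, ← map_mul act, mul_inv_cancel_left, h] at h1
    exact (mul_left_cancel h1).symm
  have hwI := mem_centralLayers_of_map_act f hf hf' hact ht hL hI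
    (mul_mem (inv_mem (layers_mono Set.inter_subset_left hm)) hnI) htriv
  have hwJ := mem_centralLayers_of_map_act f hf hf' hact ht hL hJ
    (mul_mem (inv_mem (layers_mono Set.inter_subset_right hm)) hnJ) htriv
  obtain ⟨c, hc, hcx⟩ := exists_act_centralLayers ht hL hwI
  obtain ⟨c', hc', hcx'⟩ := exists_act_centralLayers ht hL hwJ
  obtain rfl : c = c' :=
    centralSeq_injective (mul_right_cancel ((hcx 1).symm.trans (hcx' 1)))
  have hw := centralLayers_le_layers _
    (mem_centralLayers_of_act hact ht hL (mem_span_inter hc hc') hcx)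
  simpa using mul_mem hm hw

theorem exists_centralLayers_factors (hact : Function.Injective act) (ht : act t = perm G)
    (hL : ∀ g x, act (L g) x = Function.const ℕ g * x) {I J : Set ℤ} (hIJ : I ∪ J = Set.univ)
    {w : Γ} (hw : w ∈ centralLayers t L Set.univ) :
    ∃ a ∈ centralLayers t L I, ∃ b ∈ centralLayers t L J, w = a * b := by
  have hcomm : ∀ a ∈ centralLayers t L I, ∀ b ∈ centralLayers t L J, b * a = a * b :=
    fun a ha b hb => layers_comm_centralLayers hact ht hL (centralLayers_le_layers _ hb) ha
  induction hw using Subgroup.closure_induction with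
  | mem w hw =>
    obtain ⟨k, -, z, rfl⟩ := hw
    rcases (hIJ ▸ Set.mem_univ k : k ∈ I ∪ J) with hk | hk
    · exact ⟨_, layer_mem_centralLayers hk z, 1, one_mem _, (mul_one _).symm⟩
    · exact ⟨1, one_mem _, _, layer_mem_centralLayers hk z, (one_mul _).symm⟩
  | one => exact ⟨1, one_mem _, 1, one_mem _, (mul_one _).symm⟩
  | mul x y _ _ hx hy =>
    obtain ⟨a, ha, b, hb, rfl⟩ := hx
    obtain ⟨a', ha', b', hb', rfl⟩ := hy
    refine ⟨a * a', mul_mem ha ha', b * b', mul_mem hb hb', ?_⟩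
    rw [mul_assoc, ← mul_assoc b, hcomm _ ha' _ hb]
    simp only [mul_assoc]
  | inv x _ hx =>
    obtain ⟨a, ha, b, hb, rfl⟩ := hx
    exact ⟨a⁻¹, inv_mem ha, b⁻¹, inv_mem hb, by
      rw [mul_inv_rev, hcomm _ (inv_mem ha) _ (inv_mem hb)]⟩

/-- Generators are collected one at a time. Moving one from a layer in `I` to the left past the
`J`-part costs a commutator from the central layers; this splits along `I` and `J`, and its parts
move freely. -/
theorem exists_layers_factors (hf : f.ker = Subgroup.center G)
    (hact : Function.Injective act) (ht : act t = perm G)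
    (hL : ∀ g x, act (L g) x = Function.const ℕ g * x) {I J : Set ℤ} (hIJ : I ∪ J = Set.univ)
    {n : Γ} (hn : n ∈ layers t L Set.univ) :
    ∃ b ∈ layers t L I, ∃ a ∈ layers t L J, n = b * a := by
  have step : ∀ n, (∃ b ∈ layers t L I, ∃ a ∈ layers t L J, n = b * a) → ∀ k g,
      ∃ b ∈ layers t L I, ∃ a ∈ layers t L J, n * layer t L k g = b * a := by
    rintro _ ⟨b, hb, a, ha, rfl⟩ k g
    rcases (hIJ ▸ Set.mem_univ k : k ∈ I ∪ J) with hk | hk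
    · have hg := layer_mem_layers (t := t) (L := L) hk g
      have hw : ⁅a⁻¹, (layer t L k g)⁻¹⁆ ∈ centralLayers t L Set.univ :=
        commutator_mem_centralLayers f hf hact ht hL Set.ordConnected_univ
          (inv_mem (layers_mono (Set.subset_univ _) ha))
          (inv_mem (layers_mono (Set.subset_univ _) hg))
      obtain ⟨c, hc, d, hd, hcd⟩ := exists_centralLayers_factors hact ht hL hIJ hw
      refine ⟨b * layer t L k g * c, mul_mem (mul_mem hb hg) (centralLayers_le_layers _ hc),
        a * d, mul_mem ha (centralLayers_le_layers _ hd), ?_⟩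
      have h1 : a * layer t L k g = layer t L k g * a * ⁅a⁻¹, (layer t L k g)⁻¹⁆ := by
        rw [commutatorElement_def]; group
      rw [mul_assoc, h1, hcd]
      have h2 : a * c = c * a := layers_comm_centralLayers hact ht hL ha hc
      simp only [mul_assoc]
      rw [← mul_assoc a c d, h2]
      simp only [mul_assoc]
    · exact ⟨b, hb, a * layer t L k g, mul_mem ha (layer_mem_layers hk g), mul_assoc _ _ _⟩
  induction hn using Subgroup.closure_induction_right with
  | one => exact ⟨1, one_mem _, 1, one_mem _, (mul_one _).symm⟩
  | mul_right x _ y hy ih =>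
    obtain ⟨k, -, g, rfl⟩ := hy
    exact step x ih k g
  | mul_inv_cancel x _ y hy ih =>
    obtain ⟨k, -, g, rfl⟩ := hy
    rw [← map_inv]
    exact step x ih k g⁻¹

/-- Elements of the layers commute with central translations, whereas `t ^ k` turns translation by
`iter 0 z` into translation by `iter k z`. For `z ≠ 1` these agree only if `k = 0`. -/
theorem zpow_mem_layers [Nontrivial (Subgroup.center G)] (ht : act t = perm G)
    (hL : ∀ g x, act (L g) x = Function.const ℕ g * x) {I : Set ℤ} {k : ℤ}
    (hk : t ^ k ∈ layers t L I) : k = 0 := by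
  obtain ⟨z, hz⟩ := exists_ne (1 : Subgroup.center G)
  have h := act_centralSeq_mul ht hL hk (iter 0 z) 1
  rw [map_zpow, ht, perm_zpow_centralSeq_mul, perm_zpow_iter] at h
  simpa using iter_left_injective hz (centralSeq_injective (mul_right_cancel h))

/-- If `N` is normalized by `t` and every element is uniquely of the form `n * t ^ k` with
`n ∈ N`, then the exponent is a homomorphism with kernel `N`. -/
theorem exists_exponentHom (N : Subgroup Γ)
    (hconj : ∀ n ∈ N, ∀ k : ℤ, t ^ k * n * (t ^ k)⁻¹ ∈ N)
    (hex : ∀ γ, ∃ k : ℤ, γ * t ^ (-k) ∈ N) (huniq : ∀ k : ℤ, t ^ k ∈ N → k = 0) :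
    ∃ π : Γ →* Multiplicative ℤ, π t = Multiplicative.ofAdd 1 ∧ π.ker = N := by
  choose p hp using hex
  have hpu : ∀ γ k, γ * t ^ (-k) ∈ N → p γ = k := by
    intro γ k h
    have h1 := mul_mem (inv_mem (hp γ)) h
    have h2 := huniq (p γ - k) (by
      convert h1 using 1
      group)
    omega
  refine ⟨MonoidHom.mk' (fun γ => Multiplicative.ofAdd (p γ)) fun γ δ => ?_, ?_, ?_⟩
  · rw [← ofAdd_add]
    congr 1
    apply hpu
    have := mul_mem (hp γ) (hconj _ (hp δ) (p γ))
    convert this using 1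
    group
  · change Multiplicative.ofAdd (p t) = _
    rw [hpu t 1 (by simp)]
  · ext γ
    rw [MonoidHom.mem_ker]
    constructor
    · intro h
      have h0 : p γ = 0 := h
      simpa [h0] using hp γ
    · intro h
      exact congrArg Multiplicative.ofAdd (hpu γ 0 (by simpa using h))

theorem exists_mul_zpow_mem_layers (hgen : Subgroup.closure (Set.range fun g => L g * t) = ⊤)
    (γ : Γ) : ∃ k : ℤ, γ * t ^ (-k) ∈ layers t L Set.univ := by
  have hγ : γ ∈ Subgroup.closure (Set.range fun g => L g * t) := hgen ▸ Subgroup.mem_top γ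
  have hconj : ∀ n ∈ layers t L Set.univ, ∀ k : ℤ, t ^ k * n * (t ^ k)⁻¹ ∈ layers t L Set.univ :=
    fun n hn k => conj_mem_layers (fun _ _ => Set.mem_univ _) hn
  induction hγ using Subgroup.closure_induction with
  | mem γ hγ =>
    obtain ⟨g, rfl⟩ := hγ
    refine ⟨1, ?_⟩
    have : L g * t * t ^ (-1 : ℤ) = layer t L 0 g := by simp [layer_apply]
    dsimp only
    rw [this]
    exact layer_mem_layers (Set.mem_univ _) g
  | one => exact ⟨0, by simp⟩
  | mul γ δ _ _ h h' =>
    obtain ⟨k, h⟩ := h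
    obtain ⟨l, h'⟩ := h'
    refine ⟨k + l, ?_⟩
    convert mul_mem h (hconj _ h' k) using 1
    group
  | inv γ _ h =>
    obtain ⟨k, h⟩ := h
    refine ⟨-k, ?_⟩
    convert hconj _ (inv_mem h) (-k) using 1
    group

/-- A group that acts faithfully on the sequences over `G` and is generated by the permutations
that the states of the Cayley machine define on them has a regular action on a Diestel–Leader
graph. -/
theorem exists_action_dlGraph [Finite G] [Nontrivial (Subgroup.center G)]
    (hf : f.ker = Subgroup.center G) (hf' : Function.Surjective f)
    (hact : Function.Injective act) (ht : act t = perm G)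
    (hL : ∀ g x, act (L g) x = Function.const ℕ g * x)
    (hgen : Subgroup.closure (Set.range fun g => L g * t) = ⊤) :
    ∃ φ : Γ →* GraphIsom (dlGraph (Nat.card G) (Nat.card G)), Function.Injective φ ∧
      IsCocompactLattice φ.range ∧ IsProperGraphAction φ ∧ IsTransitiveGraphAction φ := by
  obtain ⟨π, hπt, hπ⟩ := exists_exponentHom (layers t L Set.univ)
    (fun n hn k => conj_mem_layers (fun _ _ => Set.mem_univ _) hn)
    (exists_mul_zpow_mem_layers hgen) (fun k hk => zpow_mem_layers ht hL hk)
  have hinter : ∀ k : ℤ, layers t L (Set.Ici k) ⊓ layers t L (Set.Iio (k + 1)) =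
      (layer t L k).range := by
    intro k
    rw [layers_inter f hf hf' hact ht hL Set.ordConnected_Ici Set.ordConnected_Iio,
      ← layers_singleton]
    congr 1
    ext i
    simp only [Set.mem_inter_iff, Set.mem_Ici, Set.mem_Iio, Set.mem_singleton_iff]
    omega
  have hinter0 : layers t L (Set.Ici 0) ⊓ layers t L (Set.Iio 1) = L.range := by
    have := hinter 0
    rw [zero_add] at this
    rw [this]
    congr 1
    ext g
    simp [layer_apply]
  have hinj : ∀ k, Function.Injective (layer t L k) := by
    intro k
    rw [injective_iff_map_eq_one]
    intro g hg
    rw [layer_apply, conj_eq_one_iff] at hg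
    have := hL g 1
    rw [hg, map_one act] at this
    simpa using (congrFun this 0).symm
  obtain ⟨e, he⟩ := exists_equiv_dlVertex π t hπt (fun k => layers t L (Set.Ici k))
    (fun k => layers t L (Set.Iio k)) (q := Nat.card G) Nat.card_pos
    (fun k => hπ ▸ layers_mono (Set.subset_univ _)) (fun k => hπ ▸ layers_mono (Set.subset_univ _))
    (fun j k h => layers_mono (Set.Ici_subset_Ici.2 h))
    (fun j k h => layers_mono (Set.Iio_subset_Iio h))
    (fun n hn => exists_mem_layers_Ici (hπ ▸ hn)) (fun n hn => exists_mem_layers_Iio (hπ ▸ hn))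
    (fun k x h1 h2 => by
      have h3 : x ∈ layers t L (Set.Ici k) ⊓ layers t L (Set.Iio k) := ⟨h1, h2⟩
      rw [layers_inter f hf hf' hact ht hL Set.ordConnected_Ici Set.ordConnected_Iio,
        Set.Ici_inter_Iio, Set.Ico_self] at h3
      simpa [layers] using h3)
    (fun k n hn => exists_layers_factors f hf hact ht hL Set.Iio_union_Ici (hπ ▸ hn))
    (fun k => by
      rw [hinter]
      exact (Nat.card_congr (MonoidHom.ofInjective (hinj k)).toEquiv).symm)
    (fun k x => by
      rw [hinter, hinter0]
      constructor
      · rintro ⟨g, rfl⟩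
        exact ⟨g, by rw [layer_apply]; group⟩
      · rintro ⟨g, hg⟩
        exact ⟨g, by rw [layer_apply, hg]; group⟩)
  have hS : (fun h => h * t) '' ((layers t L (Set.Ici 0) ⊓ layers t L (Set.Iio 1) : Subgroup Γ) :
      Set Γ) = Set.range fun g => L g * t := by
    rw [hinter0, MonoidHom.coe_range, ← Set.range_comp]
    rfl
  exact exists_regular_action e _ (Set.finite_range fun g => L g * t) hgen fun γ γ' => by
    rw [he, hS]

end Structure

end PrefixProduct

/-! ### From finite words to infinite sequences: the automata group -/

namespace PrefixProduct

variable {G : Type u}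

/-- The word consisting of the first `n` letters of a sequence. -/
def word (x : ℕ → G) (n : ℕ) : List G := (List.range n).map x

theorem word_succ (x : ℕ → G) (n : ℕ) : word x (n + 1) = x 0 :: word (fun i => x (i + 1)) n := by
  simp [word, List.range_succ_eq_map]

theorem word_injective {x y : ℕ → G} (h : ∀ n, word x n = word y n) : x = y := by
  funext i
  have := congrArg (fun l => l[i]?) (h (i + 1))
  simpa [word] using this

/-- Uniqueness of the extension to sequences makes the chosen extensions multiplicative in
`seqAction`. -/
theorem perm_word_unique {σ : Equiv.Perm (List G)} {τ τ' : Equiv.Perm (ℕ → G)}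
    (h : ∀ x n, σ (word x n) = word (τ x) n) (h' : ∀ x n, σ (word x n) = word (τ' x) n) :
    τ = τ' :=
  Equiv.ext fun x => word_injective fun n => (h x n).symm.trans (h' x n)

variable [Group G]

theorem exists_eq_word (l : List G) : ∃ x n, l = word x n := by
  induction l with
  | nil => exact ⟨1, 0, rfl⟩
  | cons a l ih =>
    obtain ⟨x, n, rfl⟩ := ih
    let y : ℕ → G := fun
      | 0 => a
      | i + 1 => x i
    exact ⟨y, n + 1, (word_succ y n).symm⟩

theorem prods_succ (x : ℕ → G) (n : ℕ) : prods x (n + 1) = x 0 * prods (fun i => x (i + 1)) n := by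
  induction n with
  | zero => rfl
  | succ n ih => rw [prods, ih, prods, mul_assoc]

/-- The machine outputs the state it enters, which is `g` times the product of the letters read so
far. -/
theorem run_cayleyMachine_word (g : G) (x : ℕ → G) (n : ℕ) :
    (cayleyMachine G).run g (word x n) = word (Function.const ℕ g * prods x) n := by
  induction n generalizing g x with
  | zero => rfl
  | succ n ih =>
    rw [word_succ, word_succ, MealyAutomaton.run]
    change g * x 0 :: (cayleyMachine G).run (g * x 0) _ = _
    rw [ih]
    congr 2
    funext i
    simp [prods_succ, mul_assoc]

theorem exists_perm_word {σ : Equiv.Perm (List G)} (hσ : σ ∈ cayleyAutomataGroup G) :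
    ∃ τ : Equiv.Perm (ℕ → G), ∀ x n, σ (word x n) = word (τ x) n := by
  induction hσ using Subgroup.closure_induction with
  | mem σ hσ =>
    obtain ⟨g, rfl⟩ := hσ
    exact ⟨Equiv.mulLeft (Function.const ℕ g) * perm G, run_cayleyMachine_word g⟩
  | one => exact ⟨1, fun _ _ => rfl⟩
  | mul σ σ' _ _ h h' =>
    obtain ⟨τ, h⟩ := h
    obtain ⟨τ', h'⟩ := h'
    exact ⟨τ * τ', fun x n => by rw [Equiv.Perm.mul_apply, h', h, Equiv.Perm.mul_apply]⟩
  | inv σ _ h =>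
    obtain ⟨τ, h⟩ := h
    refine ⟨τ⁻¹, fun x n => ?_⟩
    rw [Equiv.Perm.inv_eq_iff_eq, h]
    exact congrArg (word · n) (τ.apply_symm_apply x).symm

variable (G) in
/-- The action of the automata group of the Cayley machine on infinite sequences. -/
noncomputable def seqAction : cayleyAutomataGroup G →* Equiv.Perm (ℕ → G) :=
  MonoidHom.mk' (fun σ => (exists_perm_word σ.2).choose) fun σ σ' => by
    refine perm_word_unique (exists_perm_word (σ * σ').2).choose_spec fun x n => ?_
    rw [Subgroup.coe_mul, Equiv.Perm.mul_apply, (exists_perm_word σ'.2).choose_spec,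
      (exists_perm_word σ.2).choose_spec, Equiv.Perm.mul_apply]

theorem word_seqAction (σ : cayleyAutomataGroup G) (x : ℕ → G) (n : ℕ) :
    (σ : Equiv.Perm (List G)) (word x n) = word (seqAction G σ x) n :=
  (exists_perm_word σ.2).choose_spec x n

theorem seqAction_injective : Function.Injective (seqAction G) := by
  intro σ σ' h
  refine Subtype.ext (Equiv.ext fun l => ?_)
  obtain ⟨x, n, rfl⟩ := exists_eq_word l
  rw [word_seqAction, word_seqAction, h]

/-- The element of the automata group of the Cayley machine given by a state. -/
noncomputable def state (g : G) : cayleyAutomataGroup G :=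
  ⟨(cayleyMachine G).statePerm (cayleyMachine_isInvertible G) g, Subgroup.subset_closure ⟨g, rfl⟩⟩

theorem seqAction_state (g : G) :
    seqAction G (state g) = Equiv.mulLeft (Function.const ℕ g) * perm G :=
  perm_word_unique (word_seqAction (state g)) (run_cayleyMachine_word g)

theorem seqAction_state_one : seqAction G (state 1) = perm G := by
  rw [seqAction_state]
  ext x : 1
  exact one_mul _

theorem seqAction_state_mul_inv (g : G) :
    seqAction G (state g * (state 1)⁻¹) = Equiv.mulLeft (Function.const ℕ g) := by
  rw [map_mul, map_inv, seqAction_state, seqAction_state_one, mul_inv_cancel_right]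

variable (G) in
/-- The elements of the automata group of the Cayley machine that multiply all letters of a word by
the same group element. -/
noncomputable def leftMul : G →* cayleyAutomataGroup G :=
  MonoidHom.mk' (fun g => state g * (state 1)⁻¹) fun g h => seqAction_injective (by
    rw [map_mul (seqAction G) (state g * (state 1)⁻¹)]
    simp only [seqAction_state_mul_inv]
    ext x : 1
    exact mul_assoc _ _ _)

theorem leftMul_mul_state (g : G) : leftMul G g * state 1 = state g :=
  inv_mul_cancel_right _ _

theorem closure_range_state :
    Subgroup.closure (Set.range (state : G → cayleyAutomataGroup G)) = ⊤ := by
  refine Eq.trans (congrArg _ ?_) Subgroup.closure_closure_coe_preimage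
  ext σ
  constructor
  · rintro ⟨g, rfl⟩
    exact ⟨g, rfl⟩
  · rintro ⟨g, hg⟩
    exact ⟨g, Subtype.ext hg⟩

-- The class bound enters as commutativity of `G ⧸ Subgroup.center G`, the group `V` of the
-- structure theory. Nilpotency and nontriviality make the centre nontrivial, which is what
-- separates the powers of `t` from the layers.
open scoped IsMulCommutative in
theorem exists_cayley_action_dlGraph (G : Type u) [Group G] [Finite G] [Nontrivial G]
    [Group.IsNilpotent G] (hclass : Group.nilpotencyClass G ≤ 2) :
    ∃ φ : cayleyAutomataGroup G →* GraphIsom (dlGraph (Nat.card G) (Nat.card G)),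
      Function.Injective φ ∧ IsCocompactLattice φ.range ∧
        IsProperGraphAction φ ∧ IsTransitiveGraphAction φ := by
  have hcomm : IsMulCommutative (G ⧸ Subgroup.center G) := by
    rw [← Group.IsNilpotent.nilpotencyClass_le_one_iff, Group.nilpotencyClass_quotient_center]
    omega
  have : Nontrivial (Subgroup.center G) :=
    (Subgroup.nontrivial_iff_ne_bot _).2 (Group.IsNilpotent.center_ne_bot G)
  exact exists_action_dlGraph (t := state 1) (L := leftMul G)
    (act := seqAction G) (V := G ⧸ Subgroup.center G) (QuotientGroup.mk' (Subgroup.center G))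
    (QuotientGroup.ker_mk' _) (QuotientGroup.mk'_surjective _) seqAction_injective
    seqAction_state_one
    (fun g x => by
      rw [show leftMul G g = state g * (state 1)⁻¹ from rfl, seqAction_state_mul_inv]
      rfl)
    (by simp only [leftMul_mul_state]; exact closure_range_state)

end PrefixProduct

theorem theorem4 (G : Type u) [Group G] [Finite G] [Nontrivial G] [Group.IsNilpotent G]
    (hclass : Group.nilpotencyClass G ≤ 2)
    (hsq : ∀ g : G, g ^ 2 ∈ Subgroup.center G) :
    IsCrossWiredLamplighter (cayleyAutomataGroup G) ∧
      ∃ q : ℕ, 2 ≤ q ∧ ∃ φ : cayleyAutomataGroup G →* GraphIsom (dlGraph q q),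
        Function.Injective φ ∧ IsCocompactLattice φ.range ∧
          IsProperGraphAction φ ∧ IsTransitiveGraphAction φ := by
  have hq : 2 ≤ Nat.card G := Finite.one_lt_card
  obtain ⟨φ, h1, h2, h3⟩ := PrefixProduct.exists_cayley_action_dlGraph G hclass
  exact ⟨⟨_, _, hq, hq, φ, h1, h2⟩, _, hq, φ, h1, h2, h3⟩
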